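/- For a congruence subgroup $\varGamma\subset\mathrm{SL}_2(\mathbb Z)$ and an integer $k\ge 0$ let $\mathcal M(\varGamma)_k$ be the $\mathbb C$-vector space of holomorphic modular forms of weight $k$ for $\varGamma$ (holomorphic on the upper half plane and at all cusps), and let $\mathcal M(\varGamma)_{\ast}=\bigoplus_{k\ge 0}\mathcal M(\varGamma)_k$ be the graded ring of modular forms. Let $\Gamma(N)$ be the principal congruence subgroup of level $N$. For $\tau$ in the upper half plane put $q=e^{2\pi i\tau}$ and \[\eta(\tau)=e^{2\pi i\tau/24}\prod_{n\ge1}(1-q^n),\qquad E_{1,2}(\tau)=1-24\sum_{n\ge1}\Big(\sum_{d\mid n}d\Big)q^n,\] \[E_{2,2}(\tau)=2E_{1,2}(2\tau)-E_{1,2}(\tau),\qquad E_{\chi_3}(\tau)=1-\frac{2}{B_{\chi_3}}\sum_{n\ge1}\Big(\sum_{d\mid n}\chi_3(d)\Big)q^n=1+6\sum_{n\ge1}\Big(\sum_{d\mid n}\chi_3(d)\Big)q^n,\] where $\chi_3=\left(\frac{\cdot}{3}\right)$ is the nontrivial Dirichlet character modulo $3$ and $B_{\chi_3}=\frac13\sum_{a=1}^{3}\chi_3(a)\,a=-\frac13$.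 Put \[\eta^{\flat}(\tau)=\frac{\eta(\tau/2)^2}{\eta(\tau)},\quad \eta^{\sharp}(\tau)=\frac{\eta(2\tau)^2}{\eta(\tau)},\quad \eta^{\bot}(\tau)=\frac{\eta(\tau/3)^3}{\eta(\tau)},\quad \eta^{\top}(\tau)=\frac{\eta(3\tau)^3}{\eta(\tau)}.\] (1) The functions $E_{2,2}(\tau/2)$, $E_{2,2}(\tau)$, $(\eta^{\flat})^4$, $(\eta^{\sharp})^4$ belong to $\mathcal M(\Gamma(2))_2$, and \[\mathcal M(\Gamma(2))_{\ast}=\mathbb C\big[E_{2,2}(\tau/2),E_{2,2}(\tau)\big]=\mathbb C\big[(\eta^{\flat})^4,(\eta^{\sharp})^4\big].\] (2) The functions $E_{\chi_3}(\tau/3)$, $E_{\chi_3}(\tau)$, $\eta^{\bot}$, $\eta^{\top}$ belong to $\mathcal M(\Gamma(3))_1$, and \[\mathcal M(\Gamma(3))_{\ast}=\mathbb C\big[E_{\chi_3}(\tau/3),E_{\chi_3}(\tau)\big]=\mathbb C\big[\eta^{\bot},\eta^{\top}\big].\] In each of the four presentations $\mathbb C[x,y]$ the two generators $x,y$ are algebraically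 independent over $\mathbb C$, so that the graded ring is a polynomial ring in two variables. -/

import Mathlib

open UpperHalfPlane

open scoped DirectSum CongruenceSubgroup

noncomputable section

/-- The space of modular forms of weight `k ≥ 0` for `Γ`, as a space of functions on the upper half
plane. -/
def modularForms (Γ : Subgroup (GL (Fin 2) ℝ)) [Γ.HasDetOne] (k : ℕ) : Submodule ℂ (ℍ → ℂ) where
  carrier := {f | ∃ g : ModularForm Γ (k : ℤ), ⇑g = f}
  add_mem' := by
    rintro _ _ ⟨f, rfl⟩ ⟨g, rfl⟩
    exact ⟨f + g, FunLike.coe_add f g⟩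
  zero_mem' := ⟨0, FunLike.coe_zero⟩
  smul_mem' := by
    rintro c _ ⟨f, rfl⟩
    exact ⟨c • f, FunLike.coe_smul c f⟩

/-- Products of forms are forms and the weights add up; hence `⨁ k, modularForms Γ k` is a graded
commutative `ℂ`-algebra. -/
instance modularForms.instGradedMonoid (Γ : Subgroup (GL (Fin 2) ℝ)) [Γ.HasDetOne] :
    SetLike.GradedMonoid (modularForms Γ) where
  one_mem := ⟨ModularForm.mcast (by simp) (1 : ModularForm Γ 0), rfl⟩
  mul_mem := by
    rintro i j _ _ ⟨f, rfl⟩ ⟨g, rfl⟩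
    exact ⟨ModularForm.mcast (by simp) (f.mul g), rfl⟩

/-- The graded ring of all modular forms of weight `0, 1, 2, …` for `Γ`. -/
abbrev ModularFormRing (Γ : Subgroup (GL (Fin 2) ℝ)) [Γ.HasDetOne] : Type :=
  ⨁ k : ℕ, modularForms Γ k

/-- A form of weight `k`, seen as a homogeneous element of the graded ring. -/
def ModularFormRing.ofForm {Γ : Subgroup (GL (Fin 2) ℝ)} [Γ.HasDetOne] {k : ℕ}
    (f : modularForms Γ k) : ModularFormRing Γ :=
  DirectSum.of (fun i : ℕ => modularForms Γ i) k f

/-- The `ℂ`-algebra `R` is `ℂ[x, y]`, a polynomial ring in the two elements `x` and `y`. -/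
def IsPolynomialRingIn {R : Type*} [CommRing R] [Algebra ℂ R] (x y : R) : Prop :=
  AlgebraicIndependent ℂ ![x, y] ∧ Algebra.adjoin ℂ {x, y} = ⊤

/-- The function `τ ↦ f (h τ)`, for a real number `h > 0`. -/
def rescale (h : ℝ) (hh : 0 < h) (f : ℍ → ℂ) : ℍ → ℂ :=
  fun τ => f ((⟨h, hh⟩ : {x : ℝ // 0 < x}) • τ)

/-- `E_{2,2}(τ) = 2 E_{1,2}(2τ) - E_{1,2}(τ)`, where `E_{1,2} = 1 - 24 q - ⋯` is the normalised
Eisenstein series of weight two and level one. -/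
def eisensteinTwoTwo : ℍ → ℂ :=
  fun τ => 2 * rescale 2 two_pos EisensteinSeries.E2 τ - EisensteinSeries.E2 τ

/-- The first generalised Bernoulli number of a primitive Dirichlet character modulo `N`. -/
def bernoulliOne {N : ℕ} (χ : DirichletCharacter ℂ N) : ℂ :=
  (1 / (N : ℂ)) * ∑ a ∈ Finset.Icc 1 N, χ (a : ZMod N) * (a : ℂ)

/-- The Eisenstein series `E_χ = 1 - (2 / B_χ) ∑_{n ≥ 1} (∑_{d ∣ n} χ(d)) q^n` of weight one, for an
odd primitive Dirichlet character `χ`. -/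
def eisensteinWeightOne {N : ℕ} (χ : DirichletCharacter ℂ N) : ℍ → ℂ :=
  fun τ => 1 - (2 / bernoulliOne χ) *
    ∑' n : ℕ+, (∑ d ∈ (n : ℕ).divisors, χ (d : ZMod N)) *
      Complex.exp (2 * Real.pi * Complex.I * (τ : ℂ)) ^ (n : ℕ)

/-- The quadratic (Legendre) character modulo three. -/
def chiThree : DirichletCharacter ℂ 3 :=
  (quadraticChar (ZMod 3)).ringHomComp (Int.castRingHom ℂ)

/-- The eta quotient `η(τ/n)^n / η(τ)`. -/
def etaLower (n : ℕ) : ℍ → ℂ :=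
  fun τ => ModularForm.eta ((τ : ℂ) / n) ^ n / ModularForm.eta τ

/-- The eta quotient `η(nτ)^n / η(τ)`. -/
def etaUpper (n : ℕ) : ℍ → ℂ :=
  fun τ => ModularForm.eta (n * (τ : ℂ)) ^ n / ModularForm.eta τ

end

/-! Let y be (η^♯)^4 with N = 2, w = 2, or η^⊤ with N = 3, w = 1. As an eta quotient, y has no zero
on ℍ. At i∞ it starts with q^(1/N), a simple zero in the local parameter of Γ(N), and at all other
cusps it has a nonzero limit. Hence every form vanishing at i∞ is y times a form of weight lower by
w (`IsSlashOrbit.hasDivision`).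

Let x be (η^♭)^4 or η^⊥, with constant term 1. From a form of weight w(n+1) subtract the multiple of
x^(n+1) with the same constant term, divide by y and induct on the weight: x and y generate
(`ModularFormRing.ofForm_mem_adjoin`). They are independent because a homogeneous relation is a
polynomial equation for y/x, which tends to 0 at i∞ without being 0
(`ModularFormRing.algebraicIndependent`).

Two different forms of weight w with constant term 1 differ by a nonzero multiple of y, so they span
x and y and also generate (`HasDivision.isPolynomialRingIn_of_ne`). This covers the Eisenstein
series.

Modularity is proved by exhibiting a family of functions indexed by SL(2, ℤ/N) on which S and T act
by translation: Γ(N) then fixes the member at 1, and limits of the members control all cusps. For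
eta quotients the family comes from the transformation laws of η. For an Eisenstein series E it
comes from period 1 and a relation E ∣ S = κ E(τ/N). At level two this relation follows from the
quasi-modularity of E₂. At level three, the Weierstrass zeta function at z = 1/3 and z = τ/3 yields
E(τ) and E(τ/3), and S exchanges the two points. -/

section

open Filter Topology ModularGroup
open scoped ModularForm MatrixGroups Manifold Real

/-! ### Generators of a polynomial ring -/

/-- A surjective endomorphism of a Noetherian ring is injective. -/
theorem IsNoetherianRing.injective_of_surjective_ringHom {R : Type*} [CommRing R]
    [IsNoetherianRing R] (φ : R →+* R) (hφ : Function.Surjective φ) : Function.Injective φ := by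
  rw [injective_iff_map_eq_zero]
  intro a ha
  let K : ℕ →o Ideal R := ⟨fun n ↦ RingHom.ker (φ ^ n), monotone_nat_of_le_succ fun n b hb ↦ by
    rw [RingHom.mem_ker] at hb ⊢
    rw [pow_succ', RingHom.coe_mul, Function.comp_apply, hb, map_zero]⟩
  obtain ⟨n, hn⟩ := monotone_stabilizes_iff_noetherian.mpr ‹_› K
  -- The kernels of the iterates stabilise at `n`. Writing an element of ker φ as `φ ^ n b` puts `b`
  -- in the kernel of `φ ^ (n + 1)`, which is that of `φ ^ n`.
  have hsurj : Function.Surjective (φ ^ n) := by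
    rw [RingHom.coe_pow]; exact hφ.iterate n
  obtain ⟨b, rfl⟩ := hsurj a
  have hb : b ∈ K (n + 1) := by
    change b ∈ RingHom.ker (φ ^ (n + 1))
    rwa [RingHom.mem_ker, pow_succ', RingHom.coe_mul, Function.comp_apply]
  rw [← hn (n + 1) n.le_succ] at hb
  exact hb

/-- If a polynomial ring in two variables is generated by two elements, then these are
algebraically independent. -/
theorem IsPolynomialRingIn.of_mem_adjoin {R : Type*} [CommRing R] [Algebra ℂ R] {x y x' y' : R}
    (h : IsPolynomialRingIn x y) (hx : x ∈ Algebra.adjoin ℂ {x', y'})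
    (hy : y ∈ Algebra.adjoin ℂ {x', y'}) : IsPolynomialRingIn x' y' := by
  obtain ⟨hind, htop⟩ := h
  have htop' : Algebra.adjoin ℂ {x', y'} = ⊤ := by
    rw [eq_top_iff, ← htop, Algebra.adjoin_le_iff]
    rintro _ (rfl | rfl) <;> assumption
  refine ⟨?_, htop'⟩
  have hsurj {u v : R} (huv : Algebra.adjoin ℂ {u, v} = ⊤) :
      Function.Surjective (MvPolynomial.aeval (R := ℂ) ![u, v]) := by
    rw [← AlgHom.range_eq_top, ← Algebra.adjoin_range_eq_range_aeval]
    simpa [Set.pair_comm] using huv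
  -- Transported through the known presentation, evaluation at `x'`, `y'` is a surjective
  -- endomorphism of a Noetherian ring, hence injective.
  let e : MvPolynomial (Fin 2) ℂ ≃ₐ[ℂ] R := AlgEquiv.ofBijective _ ⟨hind, hsurj htop⟩
  let φ : MvPolynomial (Fin 2) ℂ →+* MvPolynomial (Fin 2) ℂ :=
    (e.symm : R →+* MvPolynomial (Fin 2) ℂ).comp
      (MvPolynomial.aeval (R := ℂ) ![x', y'] : MvPolynomial (Fin 2) ℂ →+* R)
  have hφ : Function.Surjective φ := e.symm.surjective.comp (hsurj htop')
  exact fun a b hab ↦ IsNoetherianRing.injective_of_surjective_ringHom φ hφ (congrArg e.symm hab)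

/-! ### Generation and independence in the graded ring -/

section GradedRing

variable {Γ : Subgroup (GL (Fin 2) ℝ)} [Γ.HasDetOne]

namespace ModularFormRing

theorem of_pow_mul_of_pow_apply {w : ℕ} (x y : modularForms Γ w) (i j d : ℕ) :
    (((ofForm x ^ i * ofForm y ^ j : ModularFormRing Γ) d : modularForms Γ d) : ℍ → ℂ) =
      if (i + j) * w = d then (x : ℍ → ℂ) ^ i * (y : ℍ → ℂ) ^ j else 0 := by
  rw [ofForm, ofForm, DirectSum.ofPow, DirectSum.ofPow, DirectSum.of_mul_of]
  split_ifs with h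
  · subst h
    rw [show (i + j) * w = i • w + j • w by simp [add_mul], DirectSum.of_eq_same]
    rfl
  · rw [DirectSum.of_eq_of_ne _ _ _ (by simpa [← add_mul, eq_comm] using h)]
    rfl

/-- Two forms of the same weight, one of which tends to `1` and the other one to `0` without
vanishing, are algebraically independent. -/
theorem algebraicIndependent {w : ℕ} (hw : 0 < w) {x y : modularForms Γ w}
    (hx : Tendsto (x : ℍ → ℂ) atImInfty (𝓝 1)) (hy : Tendsto (y : ℍ → ℂ) atImInfty (𝓝 0))
    (hy0 : ∀ τ, (y : ℍ → ℂ) τ ≠ 0) : AlgebraicIndependent ℂ ![ofForm x, ofForm y] := by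
  rw [algebraicIndependent_iff]
  intro P hP
  by_contra hP0
  obtain ⟨m, hm⟩ := MvPolynomial.exists_coeff_ne_zero hP0
  -- Only the homogeneous part of `P` of the degree of `m` contributes in weight `(m 0 + m 1) * w`,
  -- so that part vanishes separately.
  set s := P.support.filter fun n ↦ n 0 + n 1 = m 0 + m 1 with hs
  have hrel : ∑ n ∈ s, P.coeff n • ((x : ℍ → ℂ) ^ n 0 * (y : ℍ → ℂ) ^ n 1) = 0 := by
    have h1 := congrArg (fun r : ModularFormRing Γ ↦
      ((r ((m 0 + m 1) * w) : modularForms Γ _) : ℍ → ℂ)) hP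
    rw [MvPolynomial.aeval_def, MvPolynomial.eval₂_eq'] at h1
    simp only [Fin.prod_univ_two, Matrix.cons_val_zero, Matrix.cons_val_one, ← Algebra.smul_def,
      DirectSum.sum_apply] at h1
    rw [AddSubmonoidClass.coe_finsetSum] at h1
    simp only [DirectSum.smul_apply, Submodule.coe_smul, of_pow_mul_of_pow_apply] at h1
    rw [hs, Finset.sum_filter]
    refine Eq.trans (Finset.sum_congr rfl fun n hn ↦ ?_) h1
    simp only [Nat.mul_left_inj hw.ne']
    split_ifs <;> simp
  -- Dehomogenise: the relation reads x^(m 0 + m 1) · p(y/x) = 0. Since the degree is fixed, the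
  -- exponent of `y` determines the monomial and `p` retains the coefficient at `m`.
  set p : Polynomial ℂ := ∑ n ∈ s, Polynomial.monomial (n 1) (P.coeff n) with hp
  have hpm : p.coeff (m 1) = P.coeff m := by
    rw [hp, Polynomial.finsetSum_coeff, Finset.sum_eq_single m]
    · simp
    · intro n hn hnm
      rw [Polynomial.coeff_monomial, if_neg]
      intro h1
      refine hnm (Finsupp.ext fun i ↦ ?_)
      have := (Finset.mem_filter.mp hn).2
      fin_cases i
      · simp only [Fin.zero_eta]; omega
      · exact h1
    · intro h
      exact absurd (by simpa [hs] using hm) h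
  have hp0 : p ≠ 0 := fun h ↦ hm (by rw [← hpm, h, Polynomial.coeff_zero])
  set t : ℍ → ℂ := fun τ ↦ (y : ℍ → ℂ) τ / (x : ℍ → ℂ) τ
  have hxne : ∀ᶠ τ in atImInfty, (x : ℍ → ℂ) τ ≠ 0 := hx.eventually_ne one_ne_zero
  have ht : Tendsto t atImInfty (𝓝[≠] 0) := by
    refine tendsto_nhdsWithin_iff.mpr ⟨by simpa using! hy.div hx one_ne_zero, ?_⟩
    filter_upwards [hxne] with τ hτ using div_ne_zero (hy0 τ) hτ
  have hroot : ∀ᶠ z in 𝓝[≠] (0 : ℂ), p.eval z ≠ 0 := by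
    have : {z | p.eval z = 0}.Finite := by
      simpa [Polynomial.IsRoot] using Polynomial.finite_setOfPred_isRoot hp0
    have h2 := this.isClosed.isOpen_compl
    by_cases h0 : p.eval 0 = 0
    · have : ({z | p.eval z = 0} \ {0}).Finite := this.sdiff
      filter_upwards [nhdsWithin_le_nhds (this.isClosed.isOpen_compl.mem_nhds (x := 0) (by simp)),
        self_mem_nhdsWithin] with z hz hz0 hzr using hz ⟨hzr, hz0⟩
    · exact nhdsWithin_le_nhds (h2.mem_nhds h0)
  obtain ⟨τ, h1, h2⟩ := ((ht.eventually hroot).and hxne).exists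
  apply h1
  rw [hp, Polynomial.eval_finsetSum]
  have h3 := congrFun hrel τ
  simp only [Finset.sum_apply, Pi.smul_apply, Pi.mul_apply, Pi.pow_apply, Pi.zero_apply,
    smul_eq_mul] at h3
  refine (mul_eq_zero.mp ?_).resolve_left (pow_ne_zero (m 0 + m 1) h2)
  rw [Finset.mul_sum, ← h3]
  refine Finset.sum_congr rfl fun n hn ↦ ?_
  rw [Polynomial.eval_monomial, ← (Finset.mem_filter.mp hn).2, div_pow, pow_add]
  field_simp

theorem ofForm_smul {k : ℕ} (c : ℂ) (f : modularForms Γ k) :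
    ofForm (c • f) = algebraMap ℂ (ModularFormRing Γ) c * ofForm f :=
  ((DirectSum.lof ℂ ℕ (fun i : ℕ ↦ modularForms Γ i) k).map_smul c f).trans
    (Algebra.smul_def (A := ModularFormRing Γ) c (ofForm f))

theorem ofForm_add {k : ℕ} (f g : modularForms Γ k) : ofForm (f + g) = ofForm f + ofForm g :=
  (DirectSum.of (fun i : ℕ ↦ modularForms Γ i) k).map_add f g

/-- The division principle: if every form vanishing at `i∞` is a multiple of `y`, and `x` does not
vanish there, then all forms are polynomials in `x` and `y`. -/
theorem ofForm_mem_adjoin {w : ℕ} (hw : 0 < w) (x y : modularForms Γ w)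
    (hconst : ∀ g ∈ modularForms Γ 0, ∃ c : ℂ, g = fun _ ↦ c)
    (hzero : ∀ k, ¬ w ∣ k → ∀ g ∈ modularForms Γ k, g = 0)
    (hlim : ∀ k, ∀ g ∈ modularForms Γ k, ∃ c : ℂ, Tendsto g atImInfty (𝓝 c))
    (hdiv : ∀ k, ∀ g ∈ modularForms Γ (k + w), Tendsto g atImInfty (𝓝 0) →
      ∃ h ∈ modularForms Γ k, g = h * y)
    (hx : Tendsto (x : ℍ → ℂ) atImInfty (𝓝 1)) (k : ℕ) (g : modularForms Γ k) :
    ofForm g ∈ Algebra.adjoin ℂ {ofForm x, ofForm y} := by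
  set S := Algebra.adjoin ℂ {ofForm x, ofForm y}
  have hxS : ofForm x ∈ S := Algebra.subset_adjoin (by simp)
  have hyS : ofForm y ∈ S := Algebra.subset_adjoin (by simp)
  induction k using Nat.strong_induction_on with
  | _ k ih =>
  obtain ⟨g, hg⟩ := g
  by_cases hk : w ∣ k
  · obtain rfl | hk0 := Nat.eq_zero_or_pos k
    · obtain ⟨c, hc⟩ := hconst g hg
      have : ofForm (⟨g, hg⟩ : modularForms Γ 0) =
          algebraMap ℂ (ModularFormRing Γ) c * 1 := by
        rw [show (1 : ModularFormRing Γ) = ofForm (⟨1, SetLike.GradedOne.one_mem⟩) from rfl,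
          ← ofForm_smul]
        congr 1
        ext τ
        simp [hc]
      rw [this]
      exact S.mul_mem (S.algebraMap_mem c) S.one_mem
    · obtain ⟨n, rfl⟩ := hk
      obtain ⟨n, rfl⟩ : ∃ m, n = m + 1 := Nat.exists_eq_succ_of_ne_zero (by rintro rfl; simp at hk0)
      have hxn : (x : ℍ → ℂ) ^ (n + 1) ∈ modularForms Γ (w * (n + 1)) := by
        rw [mul_comm]; exact SetLike.pow_mem_graded (n + 1) x.2
      have hpow : ofForm (⟨_, hxn⟩ : modularForms Γ (w * (n + 1))) = ofForm x ^ (n + 1) := by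
        rw [ofForm, ofForm, DirectSum.ofPow]
        exact DirectSum.of_eq_of_gradedMonoid_eq (Sigma.subtype_ext (mul_comm _ _) rfl)
      -- Since `x` tends to 1, subtracting `c • x ^ (n + 1)` kills the constant term; the quotient
      -- by `y` has weight `w * n`, where the induction hypothesis applies.
      obtain ⟨c, hc⟩ := hlim _ g hg
      have hd : g - c • (x : ℍ → ℂ) ^ (n + 1) ∈ modularForms Γ (w * n + w) :=
        Submodule.sub_mem _ hg (Submodule.smul_mem _ _ hxn)
      obtain ⟨h, hh, heq⟩ := hdiv _ _ hd (by
        simpa using! hc.sub ((hx.pow (n + 1)).const_smul c))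
      have key : ofForm (⟨g, hg⟩ : modularForms Γ (w * (n + 1))) =
          algebraMap ℂ (ModularFormRing Γ) c * ofForm x ^ (n + 1) +
            ofForm (⟨h, hh⟩ : modularForms Γ (w * n)) * ofForm y := by
        rw [← hpow, ← ofForm_smul]
        have : ofForm (⟨h, hh⟩ : modularForms Γ (w * n)) * ofForm y =
            ofForm (k := w * (n + 1)) ⟨_, hd⟩ := by
          rw [ofForm, ofForm, DirectSum.of_mul_of]
          exact DirectSum.of_eq_of_gradedMonoid_eq (Sigma.subtype_ext rfl heq.symm)
        rw [this, ← ofForm_add]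
        congr 1
        ext τ
        simp
      rw [key]
      exact S.add_mem (S.mul_mem (S.algebraMap_mem c) (S.pow_mem hxS _))
        (S.mul_mem (ih _ (by nlinarith) _) hyS)
  · have : (⟨g, hg⟩ : modularForms Γ k) = 0 := Subtype.ext (hzero k hk g hg)
    rw [this, ofForm, map_zero]
    exact S.zero_mem

theorem adjoin_eq_top {x y : ModularFormRing Γ}
    (h : ∀ (k : ℕ) (g : modularForms Γ k), ofForm g ∈ Algebra.adjoin ℂ {x, y}) :
    Algebra.adjoin ℂ {x, y} = ⊤ := by
  refine eq_top_iff.mpr fun r _ ↦ ?_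
  induction r using DirectSum.induction_on with
  | zero => exact Subalgebra.zero_mem _
  | of k g => exact h k g
  | add a b ha hb => exact Subalgebra.add_mem _ (ha trivial) (hb trivial)

end ModularFormRing

/-- The data needed to see that the ring of modular forms for `Γ` is a polynomial ring in two
forms `x`, `y` of weight `w`. -/
structure HasDivision (Γ : Subgroup (GL (Fin 2) ℝ)) [Γ.HasDetOne] {w : ℕ}
    (x y : modularForms Γ w) : Prop where
  pos : 0 < w
  const : ∀ g ∈ modularForms Γ 0, ∃ c : ℂ, g = fun _ ↦ c
  zero : ∀ k, ¬ w ∣ k → ∀ g ∈ modularForms Γ k, g = 0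
  lim : ∀ k, ∀ g ∈ modularForms Γ k, ∃ c : ℂ, Tendsto g atImInfty (𝓝 c)
  div : ∀ k, ∀ g ∈ modularForms Γ (k + w), Tendsto g atImInfty (𝓝 0) →
    ∃ h ∈ modularForms Γ k, g = h * y
  tendsto_left : Tendsto (x : ℍ → ℂ) atImInfty (𝓝 1)
  tendsto_right : Tendsto (y : ℍ → ℂ) atImInfty (𝓝 0)
  ne_zero : ∀ τ, (y : ℍ → ℂ) τ ≠ 0

namespace HasDivision

open ModularFormRing

variable {w : ℕ} {x y : modularForms Γ w}

theorem isPolynomialRingIn (h : HasDivision Γ x y) :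
    IsPolynomialRingIn (ofForm x) (ofForm y) :=
  ⟨algebraicIndependent h.pos h.tendsto_left h.tendsto_right h.ne_zero,
    adjoin_eq_top (ofForm_mem_adjoin h.pos x y h.const h.zero h.lim h.div h.tendsto_left)⟩

/-- The difference vanishes at i∞, so its quotient by `y` is a form of weight zero, that is, a
constant. -/
theorem sub_eq_smul (h : HasDivision Γ x y) {a b : modularForms Γ w}
    (ha : Tendsto (a : ℍ → ℂ) atImInfty (𝓝 1)) (hb : Tendsto (b : ℍ → ℂ) atImInfty (𝓝 1)) :
    ∃ c : ℂ, a - b = c • y := by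
  have hmem : ((a - b : modularForms Γ w) : ℍ → ℂ) ∈ modularForms Γ (0 + w) := by
    rw [zero_add]; exact (a - b).2
  obtain ⟨g, hg, heq⟩ := h.div 0 _ hmem (by simpa using! ha.sub hb)
  obtain ⟨c, rfl⟩ := h.const g hg
  exact ⟨c, Subtype.ext heq⟩

/-- Any two different forms of weight `w` with constant term `1` are generators. -/
theorem isPolynomialRingIn_of_ne (h : HasDivision Γ x y) {a b : modularForms Γ w}
    (ha : Tendsto (a : ℍ → ℂ) atImInfty (𝓝 1)) (hb : Tendsto (b : ℍ → ℂ) atImInfty (𝓝 1))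
    (hab : a ≠ b) : IsPolynomialRingIn (ofForm a) (ofForm b) := by
  obtain ⟨c, hc⟩ := h.sub_eq_smul ha hb
  obtain ⟨d, hd⟩ := h.sub_eq_smul h.tendsto_left hb
  -- As `c ≠ 0`, the relation a - b = c y recovers `y`, and then x = b + d y.
  have hc0 : c ≠ 0 := by
    rintro rfl
    exact hab (sub_eq_zero.mp (by simpa using hc))
  set S := Algebra.adjoin ℂ {ofForm a, ofForm b}
  have haS : ofForm a ∈ S := Algebra.subset_adjoin (by simp)
  have hbS : ofForm b ∈ S := Algebra.subset_adjoin (by simp)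
  have hy : ofForm y ∈ S := by
    have : ofForm y = algebraMap ℂ (ModularFormRing Γ) c⁻¹ * ofForm a +
        algebraMap ℂ (ModularFormRing Γ) (-c⁻¹) * ofForm b := by
      rw [sub_eq_iff_eq_add.mp hc, ofForm_add, ofForm_smul, mul_add, ← mul_assoc, ← map_mul,
        inv_mul_cancel₀ hc0, map_one, one_mul, add_assoc, ← add_mul, ← map_add, add_neg_cancel,
        map_zero, zero_mul, add_zero]
    rw [this]
    exact S.add_mem (S.mul_mem (S.algebraMap_mem _) haS) (S.mul_mem (S.algebraMap_mem _) hbS)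
  refine h.isPolynomialRingIn.of_mem_adjoin ?_ hy
  rw [sub_eq_iff_eq_add.mp hd, ofForm_add, ofForm_smul]
  exact S.add_mem (S.mul_mem (S.algebraMap_mem _) hy) hbS

end HasDivision

end GradedRing

/-! ### Forms for Γ(N): cusps, orbits and division -/

section Gamma

variable {N : ℕ} [NeZero N]

/-- Γ(N) is arithmetic, so its cusps are the translates γ∞ with γ in SL(2, ℤ), and the cusp
conditions become boundedness of all slashes at i∞. -/
theorem mem_modularForms_Gamma_iff {k : ℕ} {f : ℍ → ℂ} :
    f ∈ modularForms Γ(N) k ↔ MDiff f ∧ (∀ γ ∈ CongruenceSubgroup.Gamma N, f ∣[(k : ℤ)] γ = f) ∧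
      ∀ γ : SL(2, ℤ), IsBoundedAtImInfty (f ∣[(k : ℤ)] γ) := by
  constructor
  · rintro ⟨g, rfl⟩
    refine ⟨g.holo', fun γ hγ ↦ g.slash_action_eq' _ ⟨γ, hγ, rfl⟩, fun γ ↦ ?_⟩
    have hc : IsCusp (Matrix.SpecialLinearGroup.mapGL ℝ γ • OnePoint.infty) 𝒮ℒ :=
      isCusp_SL2Z_iff'.mpr ⟨γ, rfl⟩
    have := g.bdd_at_cusps' ((Subgroup.IsArithmetic.isCusp_iff_isCusp_SL2Z _).mpr hc)
    exact (OnePoint.isBoundedAt_iff_forall_SL2Z hc).mp this γ rfl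
  · rintro ⟨hd, hi, hb⟩
    exact ⟨{
      toFun := f
      slash_action_eq' := by
        rintro _ ⟨γ, hγ, rfl⟩
        exact hi γ hγ
      holo' := hd
      bdd_at_cusps' := fun hc ↦ by
        rw [Subgroup.IsArithmetic.isCusp_iff_isCusp_SL2Z] at hc
        exact (OnePoint.isBoundedAt_iff_forall_SL2Z hc).mpr fun γ _ ↦ hb γ }, rfl⟩

theorem slash_mem_modularForms_Gamma {k : ℕ} {f : ℍ → ℂ} (hf : f ∈ modularForms Γ(N) k)
    (γ : SL(2, ℤ)) : f ∣[(k : ℤ)] γ ∈ modularForms Γ(N) k := by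
  rw [mem_modularForms_Gamma_iff] at hf ⊢
  obtain ⟨hd, hi, hb⟩ := hf
  refine ⟨hd.slash k _, fun δ hδ ↦ ?_, fun δ ↦ ?_⟩
  · rw [← SlashAction.slash_mul, show γ * δ = γ * δ * γ⁻¹ * γ by group, SlashAction.slash_mul,
      hi _ ((CongruenceSubgroup.Gamma_normal N).conj_mem δ hδ γ)]
  · rw [← SlashAction.slash_mul]
    exact hb _

omit [NeZero N] in
theorem natCast_mem_strictPeriods_Gamma :
    (N : ℝ) ∈ (Γ(N) : Subgroup (GL (Fin 2) ℝ)).strictPeriods := by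
  rw [CongruenceSubgroup.strictPeriods_Gamma]
  exact AddSubgroup.mem_zmultiples _

theorem exists_tendsto_of_mem_modularForms_Gamma {k : ℕ} {f : ℍ → ℂ}
    (hf : f ∈ modularForms Γ(N) k) : ∃ c : ℂ, Tendsto f atImInfty (𝓝 c) := by
  obtain ⟨g, rfl⟩ := hf
  have hN : (0 : ℝ) < N := mod_cast Nat.pos_of_neZero N
  refine ⟨cuspFunction N g 0, ?_⟩
  have hc := (ModularFormClass.differentiableAt_cuspFunction g hN natCast_mem_strictPeriods_Gamma
    (q := 0) (by simp)).continuousAt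
  refine (hc.tendsto.comp (qParam_tendsto_atImInfty hN)).congr fun τ ↦ ?_
  exact SlashInvariantFormClass.eq_cuspFunction g τ natCast_mem_strictPeriods_Gamma hN.ne'

/-- A form for Γ(N) is a power series in q^(1/N); without constant term it is at most of the size of
q^(1/N). -/
theorem isBigO_exp_of_mem_modularForms_Gamma {k : ℕ} {f : ℍ → ℂ}
    (hf : f ∈ modularForms Γ(N) k) (h0 : Tendsto f atImInfty (𝓝 0)) :
    f =O[atImInfty] fun τ ↦ Real.exp (-2 * π * τ.im / N) := by
  have hb : IsBoundedAtImInfty f := by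
    simpa using (mem_modularForms_Gamma_iff.mp hf).2.2 1
  obtain ⟨g, rfl⟩ := hf
  exact IsZeroAtImInfty.exp_decay_atImInfty h0 (mod_cast Nat.pos_of_neZero N)
    (SlashInvariantFormClass.periodic_comp_ofComplex g natCast_mem_strictPeriods_Gamma) g.holo' hb

/-- If the second row of `γ` modulo `N` is `± (0, 1)`, then forms vanishing at `i∞` also vanish
at the cusp `γ ∞`. -/
theorem slash_tendsto_zero_of_mem_modularForms_Gamma {k : ℕ} {f : ℍ → ℂ}
    (hf : f ∈ modularForms Γ(N) k) (h0 : Tendsto f atImInfty (𝓝 0)) (γ : SL(2, ℤ))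
    (hc : (γ 1 0 : ZMod N) = 0) (hd : (γ 1 1 : ZMod N) = 1 ∨ (γ 1 1 : ZMod N) = -1) :
    Tendsto (f ∣[(k : ℤ)] γ) atImInfty (𝓝 0) := by
  -- Passing to -γ only multiplies the slash by (-1)^k.
  wlog h1 : (γ 1 1 : ZMod N) = 1 generalizing γ
  · have hd' : ((-γ) 1 1 : ZMod N) = 1 := by
      simp [hd.resolve_left h1]
    have hneg := this (-γ) (by simpa using hc) (Or.inl hd') hd'
    have h2 : f ∣[(k : ℤ)] γ = (-1 : ℂ) ^ k • f ∣[(k : ℤ)] (-γ) := by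
      ext τ
      rw [Pi.smul_apply, ModularForm.SL_slash_apply, ModularForm.SL_slash_apply,
        ModularGroup.SL_neg_smul, ModularGroup.denom_apply, ModularGroup.denom_apply]
      have : ((-γ) 1 0 : ℂ) * τ + (-γ) 1 1 = -1 * ((γ 1 0 : ℂ) * τ + γ 1 1) := by
        push_cast [Matrix.SpecialLinearGroup.coe_neg, Matrix.neg_apply]
        ring
      rw [this, mul_zpow, smul_eq_mul, zpow_neg, zpow_natCast, ← inv_pow]
      norm_num
      rw [mul_left_comm, ← mul_assoc ((-1 : ℂ) ^ k), mul_inv_cancel₀ (by simp), one_mul]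
    rw [h2]
    simpa using! hneg.const_smul ((-1 : ℂ) ^ k)
  have hdet : (γ 0 0 : ZMod N) * γ 1 1 - γ 0 1 * γ 1 0 = 1 := by
    have := γ.det_coe
    rw [Matrix.det_fin_two] at this
    exact_mod_cast congrArg (Int.cast : ℤ → ZMod N) this
  have ha : (γ 0 0 : ZMod N) = 1 := by simpa [hc, h1] using hdet
  -- γ is now upper unipotent modulo `N`, so it is an element of Γ(N) times a power of T, and T
  -- fixes i∞.
  have hmem : γ * (T ^ (γ 0 1))⁻¹ ∈ CongruenceSubgroup.Gamma N := by
    rw [← zpow_neg, CongruenceSubgroup.Gamma_mem]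
    simp [Matrix.SpecialLinearGroup.coe_mul, ModularGroup.coe_T_zpow, Matrix.mul_apply,
      Fin.sum_univ_two, ha, hc, h1]
  have h3 := (mem_modularForms_Gamma_iff.mp hf).2.1 _ hmem
  rw [← inv_mul_cancel_right γ (T ^ (γ 0 1)), SlashAction.slash_mul, h3]
  refine IsZeroAtImInfty.slash _ ?_ h0
  have : (((T ^ γ 0 1 : SL(2, ℤ)) 1 0 : ℤ) : ℝ) = 0 := by simp [ModularGroup.coe_T_zpow]
  simpa [-map_zpow] using this

/-- A family of functions indexed by `SL(2, ℤ/N)` on which `SL(2, ℤ)` acts by translation. -/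
structure IsSlashOrbit (k : ℤ) (F : SL(2, ZMod N) → ℍ → ℂ) : Prop where
  slash_S : ∀ g, F g ∣[k] S = F (g * Matrix.SpecialLinearGroup.map (Int.castRingHom (ZMod N)) S)
  slash_T : ∀ g, F g ∣[k] T = F (g * Matrix.SpecialLinearGroup.map (Int.castRingHom (ZMod N)) T)

namespace IsSlashOrbit

omit [NeZero N] in
theorem slash {k : ℤ} {F : SL(2, ZMod N) → ℍ → ℂ} (h : IsSlashOrbit k F) (γ : SL(2, ℤ))
    (g : SL(2, ZMod N)) :
    F g ∣[k] γ = F (g * Matrix.SpecialLinearGroup.map (Int.castRingHom (ZMod N)) γ) := by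
  have hγ : γ ∈ Subgroup.closure {S, T} := by
    simp [SpecialLinearGroup.SL2Z_generators]
  induction hγ using Subgroup.closure_induction generalizing g with
  | mem x hx =>
    obtain rfl | rfl := hx
    · exact h.slash_S g
    · exact h.slash_T g
  | one => simp
  | mul x y _ _ hx hy => rw [SlashAction.slash_mul, hx, hy, map_mul, mul_assoc]
  | inv x _ hx =>
    rw [map_inv]
    conv_lhs => rw [← inv_mul_cancel_right g
      (Matrix.SpecialLinearGroup.map (Int.castRingHom (ZMod N)) x), ← hx,
      ← SlashAction.slash_mul, mul_inv_cancel, SlashAction.slash_one]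

omit [NeZero N] in
theorem slash_one {k : ℤ} {F : SL(2, ZMod N) → ℍ → ℂ} (h : IsSlashOrbit k F) (γ : SL(2, ℤ)) :
    F 1 ∣[k] γ = F (Matrix.SpecialLinearGroup.map (Int.castRingHom (ZMod N)) γ) := by
  rw [h.slash, one_mul]

/-- Γ(N) is the kernel of reduction modulo `N`, so it fixes `F 1`; every slash of `F 1` is some `F
g`, so bounds on the family cover all cusps. -/
theorem mem_modularForms {k : ℕ} {F : SL(2, ZMod N) → ℍ → ℂ} (h : IsSlashOrbit k F)
    (hd : MDiff (F 1)) (hb : ∀ g, IsBoundedAtImInfty (F g)) : F 1 ∈ modularForms Γ(N) k := by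
  refine mem_modularForms_Gamma_iff.mpr ⟨hd, fun γ hγ ↦ ?_, fun γ ↦ ?_⟩
  · rw [h.slash_one, CongruenceSubgroup.Gamma_mem'.mp hγ]
  · rw [h.slash_one]
    exact hb _

/-- A form of weight `w` for `Γ(N)` without zeros on `ℍ` and with a simple zero at `i∞` only
divides all forms that vanish at `i∞`. -/
theorem hasDivision {w : ℕ} {F : SL(2, ZMod N) → ℍ → ℂ} (h : IsSlashOrbit (w : ℤ) F) (hw : 0 < w)
    {x y : modularForms Γ(N) w} (hy : (y : ℍ → ℂ) = F 1)
    (hrow : ∀ g : SL(2, ZMod N), g 1 0 = 0 → g 1 1 = 1 ∨ g 1 1 = -1)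
    (hcusp : ∀ g : SL(2, ZMod N), g 1 0 ≠ 0 → ∃ c : ℂ, c ≠ 0 ∧ Tendsto (F g) atImInfty (𝓝 c))
    (hinf : ∀ g : SL(2, ZMod N), g 1 0 = 0 →
      (fun τ : ℍ ↦ Real.exp (-2 * π * τ.im / N)) =O[atImInfty] F g)
    (hne : ∀ τ, F 1 τ ≠ 0) (hx : Tendsto (x : ℍ → ℂ) atImInfty (𝓝 1))
    (hy0 : Tendsto (F 1) atImInfty (𝓝 0))
    (hzero : ∀ k, ¬ w ∣ k → ∀ g ∈ modularForms Γ(N) k, g = 0) :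
    HasDivision Γ(N) x y where
  pos := hw
  const := by
    rintro _ ⟨g, rfl⟩
    obtain ⟨c, hc⟩ := ModularForm.eq_const_of_weight_zero (ModularForm.mcast (by simp) g)
    exact ⟨c, hc⟩
  zero := hzero
  lim k g hg := exists_tendsto_of_mem_modularForms_Gamma hg
  tendsto_left := hx
  tendsto_right := hy ▸ hy0
  ne_zero := hy ▸ hne
  div k g hg h0 := by
    refine ⟨g / F 1, ?_, ?_⟩
    · have hk : ((k + w : ℕ) : ℤ) - (w : ℤ) = k := by push_cast; ring
      have hF := mem_modularForms_Gamma_iff.mp (hy ▸ y.2)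
      have hg' := mem_modularForms_Gamma_iff.mp hg
      have hdiv (γ : SL(2, ℤ)) : (g / F 1) ∣[(k : ℤ)] γ =
          g ∣[((k + w : ℕ) : ℤ)] γ / F 1 ∣[(w : ℤ)] γ := by
        rw [← hk, ModularForm.div_slash_SL2]
      refine mem_modularForms_Gamma_iff.mpr ⟨?_, fun γ hγ ↦ ?_, fun γ ↦ ?_⟩
      · rw [UpperHalfPlane.mdifferentiable_iff]
        refine DifferentiableOn.div (UpperHalfPlane.mdifferentiable_iff.mp hg'.1)
          (UpperHalfPlane.mdifferentiable_iff.mp hF.1) fun z hz ↦ hne _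
      · rw [hdiv, hg'.2.1 γ hγ, hF.2.1 γ hγ]
      · rw [hdiv, h.slash_one]
        set r := Matrix.SpecialLinearGroup.map (Int.castRingHom (ZMod N)) γ with hr
        by_cases hr0 : r 1 0 = 0
        · have h1 := (isBigO_exp_of_mem_modularForms_Gamma (slash_mem_modularForms_Gamma hg γ)
            (slash_tendsto_zero_of_mem_modularForms_Gamma hg h0 γ hr0 (hrow r hr0))).trans
            (hinf r hr0)
          obtain ⟨C, hC⟩ := h1.bound
          refine Asymptotics.IsBigO.of_bound (max C 0) ?_
          filter_upwards [hC] with τ hτ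
          rw [Pi.div_apply, norm_div]
          refine div_le_of_le_mul₀ (norm_nonneg _) (by positivity) (hτ.trans ?_)
          simpa using mul_le_mul_of_nonneg_right (le_max_left C 0) (norm_nonneg _)
        -- At the other cusps the denominator has a nonzero limit, so its inverse is bounded.
        · obtain ⟨c, hc0, hc⟩ := hcusp r hr0
          have h2 : (F r)⁻¹ =O[atImInfty] (1 : ℍ → ℝ) := (hc.inv₀ hc0).isBigO_one ℝ
          simpa [div_eq_mul_inv] using! (hg'.2.2 γ).mul h2
    · rw [hy]
      ext τ
      simp [hne τ]

end IsSlashOrbit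
end Gamma

/-! ### Transformation laws and limits of eta quotients -/

section Eta

open ModularForm (eta eta_q)

theorem slash_S_apply (f : ℍ → ℂ) (k : ℤ) (τ : ℍ) :
    (f ∣[k] S) τ = f (S • τ) * (τ : ℂ) ^ (-k) := by
  rw [ModularForm.SL_slash_apply, ModularGroup.denom_S]

theorem slash_T_apply (f : ℍ → ℂ) (k : ℤ) (τ : ℍ) : (f ∣[k] T) τ = f ((1 : ℝ) +ᵥ τ) := by
  rw [ModularForm.SL_slash_apply, UpperHalfPlane.modular_T_smul, ModularGroup.denom_apply]
  simp [T]

theorem coe_S_smul (τ : ℍ) : ((S • τ : ℍ) : ℂ) = -1 / τ := by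
  rw [UpperHalfPlane.modular_S_smul, UpperHalfPlane.coe_mk, inv_neg, neg_div, one_div]

/-- S² = -1. This lets the action of S on `f ∣ S` be read off from its action on `f`. -/
theorem slash_S_slash_S (f : ℍ → ℂ) (k : ℤ) : (f ∣[k] S) ∣[k] S = (-1 : ℂ) ^ k • f := by
  ext τ
  have h : S • S • τ = τ := by
    ext
    rw [coe_S_smul, coe_S_smul]
    field_simp [τ.ne_zero]
  rw [slash_S_apply, slash_S_apply, h, coe_S_smul, Pi.smul_apply, smul_eq_mul, mul_assoc,
    ← mul_zpow, div_mul_cancel₀ _ τ.ne_zero, mul_comm, zpow_neg, ← inv_zpow]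
  norm_num

/-- The primitive 24th root of unity `e^{2πi/24}`. -/
noncomputable def zetaTwentyFour : ℂ := Complex.exp (2 * π * Complex.I / 24)

local notation "ζ₂₄" => zetaTwentyFour

theorem zetaTwentyFour_ne_zero : ζ₂₄ ≠ 0 := Complex.exp_ne_zero _

theorem zetaTwentyFour_pow_twelve : ζ₂₄ ^ 12 = -1 := by
  rw [zetaTwentyFour, ← Complex.exp_nat_mul, ← Complex.exp_pi_mul_I]
  congr 1
  push_cast
  ring

theorem zetaTwentyFour_pow_six : ζ₂₄ ^ 6 = Complex.I := by
  rw [zetaTwentyFour, ← Complex.exp_nat_mul]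
  refine Eq.trans ?_ Complex.exp_pi_div_two_mul_I
  congr 1
  push_cast
  ring

theorem zetaTwentyFour_pow : ζ₂₄ ^ 24 = 1 := by
  rw [show 24 = 12 * 2 from rfl, pow_mul, zetaTwentyFour_pow_twelve]
  norm_num

theorem sqrt_I_eq : Complex.sqrt Complex.I = ζ₂₄ ^ 3 := by
  rw [_root_.sqrt_eq_exp Complex.I_ne_zero, Complex.log_I, zetaTwentyFour, ← Complex.exp_nat_mul]
  congr 1
  push_cast
  ring

theorem sqrt_sq' (z : ℂ) : Complex.sqrt z ^ 2 = z := by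
  simp [Complex.sqrt]

theorem eta_add_one (z : ℂ) : eta (z + 1) = ζ₂₄ * eta z := by
  have h1 : Function.Periodic.qParam 24 (z + 1) = ζ₂₄ * Function.Periodic.qParam 24 z := by
    rw [Function.Periodic.qParam, Function.Periodic.qParam, zetaTwentyFour, ← Complex.exp_add]
    congr 1
    push_cast
    ring
  have h2 (n : ℕ) : eta_q n (z + 1) = eta_q n z := by
    rw [eta_q, eta_q]
    congr 1
    rw [Function.Periodic.qParam, Function.Periodic.qParam, mul_add, add_div, Complex.exp_add]
    simp
  rw [eta, eta, h1, mul_assoc]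
  simp_rw [h2]

theorem eta_add_natCast (z : ℂ) (n : ℕ) : eta (z + n) = ζ₂₄ ^ n * eta z := by
  induction n with
  | zero => simp
  | succ n ih => rw [Nat.cast_succ, ← add_assoc, eta_add_one, ih, pow_succ]; ring

theorem eta_neg_one_div {z : ℂ} (hz : 0 < z.im) :
    ζ₂₄ ^ 3 * eta (-1 / z) = Complex.sqrt z * eta z := by
  have h := ModularForm.eta_comp_eq_csqrt_I_inv hz
  simp only [Function.comp_apply, Pi.smul_apply, Pi.mul_apply, smul_eq_mul, sqrt_I_eq] at h
  rw [h, mul_inv_cancel_left₀ (pow_ne_zero _ zetaTwentyFour_ne_zero)]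

/-- The principal root halves an argument in (0, π). Being in the open first quadrant decides the
signs of square roots below. -/
theorem sqrt_re_pos_im_pos {z : ℂ} (hz : 0 < z.im) :
    0 < (Complex.sqrt z).re ∧ 0 < (Complex.sqrt z).im := by
  have h0 : z ≠ 0 := by rintro rfl; simp at hz
  have h1 := Complex.arg_lt_pi_iff.mpr (Or.inr hz.ne')
  have h2 : 0 < z.arg := by
    refine lt_of_le_of_ne (Complex.arg_nonneg_iff.mpr hz.le) fun h ↦ ?_
    rw [eq_comm, Complex.arg_eq_zero_iff] at h
    exact hz.ne' h.2
  have h3 : (Complex.log z / 2).im = z.arg / 2 := by simp [Complex.log_im]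
  rw [_root_.sqrt_eq_exp h0, Complex.exp_re, Complex.exp_im, h3]
  exact ⟨mul_pos (Real.exp_pos _) (Real.cos_pos_of_mem_Ioo ⟨by linarith, by linarith⟩),
    mul_pos (Real.exp_pos _) (Real.sin_pos_of_pos_of_lt_pi (by linarith) (by linarith))⟩

/-- The squares agree, and both sides have positive imaginary part, which excludes the opposite
sign. -/
theorem sqrt_mul_sqrt_eq {z w τ : ℂ} (hz : 0 < z.im) (hw : 0 < w.im) (hτ : 0 < τ.im)
    (h : z * w = -τ) : Complex.sqrt z * Complex.sqrt w = Complex.I * Complex.sqrt τ := by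
  obtain ⟨hz1, hz2⟩ := sqrt_re_pos_im_pos hz
  obtain ⟨hw1, hw2⟩ := sqrt_re_pos_im_pos hw
  obtain ⟨ht1, ht2⟩ := sqrt_re_pos_im_pos hτ
  have hsq : (Complex.sqrt z * Complex.sqrt w) ^ 2 = (Complex.I * Complex.sqrt τ) ^ 2 := by
    rw [mul_pow, mul_pow, sqrt_sq', sqrt_sq', sqrt_sq', h, Complex.I_sq]; ring
  refine (sq_eq_sq_iff_eq_or_eq_neg.mp hsq).resolve_right fun h' ↦ ?_
  have := congrArg Complex.im h'
  simp only [Complex.mul_im, Complex.neg_im, Complex.I_re, Complex.I_im] at this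
  nlinarith [mul_pos hz1 hw2, mul_pos hz2 hw1]

/-- The action of `S` on `η((τ + 1) / N)`. -/
theorem eta_one_add_neg_one_div_div (N : ℕ) [NeZero N] (τ : ℍ) :
    ζ₂₄ ^ (N + 1) * eta ((-1 / (τ : ℂ) + 1) / N) =
      Complex.sqrt τ * eta (((τ : ℂ) + (N - 1)) / N) := by
  have hN : (N : ℂ) ≠ 0 := NeZero.ne _
  have hN' : (0 : ℝ) < N := mod_cast Nat.pos_of_neZero N
  have hτ := τ.ne_zero
  -- With z = -1/w - N one has (-1/τ + 1)/N = -1/z: the argument is reached from `w` by S T^(-N) S,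
  -- so two inversions and one translation of η suffice. The right side is η(w + 1).
  set w : ℂ := ((τ : ℂ) - 1) / N with hw
  have hwim : 0 < w.im := by
    simp only [hw, Complex.div_natCast_im, Complex.sub_im, Complex.one_im, sub_zero]
    exact div_pos τ.im_pos hN'
  have hw0 : w ≠ 0 := by intro h; rw [h] at hwim; simp at hwim
  have hτ1 : (τ : ℂ) - 1 ≠ 0 := by intro h; rw [hw, h, zero_div] at hw0; exact hw0 rfl
  set z : ℂ := -1 / w - N with hz
  have hzim : 0 < z.im := by
    have : 0 < (-1 / w).im := by
      rw [neg_div, one_div, ← inv_neg]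
      simpa using UpperHalfPlane.im_inv_neg_coe_pos ⟨w, hwim⟩
    simpa [hz] using this
  have hzw : z * w = -τ := by
    rw [hz, sub_mul, div_mul_cancel₀ _ hw0, hw, mul_div_cancel₀ _ hN]; ring
  have hz0 : z ≠ 0 := by intro h; rw [h] at hzim; simp at hzim
  have e1 : (-1 / (τ : ℂ) + 1) / N = -1 / z := by
    have : z = -τ / w := by rw [← hzw, mul_div_cancel_right₀ _ hw0]
    rw [this, hw]
    field_simp
    ring
  have e2 : ((τ : ℂ) + (N - 1)) / N = w + 1 := by rw [hw]; field_simp; ring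
  have h1 := eta_neg_one_div hzim
  have h2 := eta_neg_one_div hwim
  have h3 : eta (-1 / w) = ζ₂₄ ^ N * eta z := by
    rw [← eta_add_natCast, hz, sub_add_cancel]
  rw [h3] at h2
  have h4 := sqrt_mul_sqrt_eq hzim hwim τ.im_pos hzw
  rw [e1, e2, eta_add_one]
  -- The factor ζ₂₄^6 = i absorbs the i from the product of the two square roots.
  refine mul_left_cancel₀ (mul_ne_zero (pow_ne_zero 6 zetaTwentyFour_ne_zero) (one_ne_zero)) ?_
  have h6 := zetaTwentyFour_pow_six
  calc ζ₂₄ ^ 6 * 1 * (ζ₂₄ ^ (N + 1) * eta (-1 / z))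
      = ζ₂₄ * (ζ₂₄ ^ 3 * (ζ₂₄ ^ N * (ζ₂₄ ^ 3 * eta (-1 / z)))) := by ring
    _ = ζ₂₄ * Complex.sqrt z * (ζ₂₄ ^ 3 * (ζ₂₄ ^ N * eta z)) := by rw [h1]; ring
    _ = ζ₂₄ * (Complex.sqrt z * Complex.sqrt w) * eta w := by rw [h2]; ring
    _ = _ := by rw [h4, h6]; ring

theorem eta_coe_ne_zero (τ : ℍ) : eta (τ : ℂ) ≠ 0 := ModularForm.eta_ne_zero τ.2

/-- The eta quotient `η((τ + j) / N) ^ N / η(τ)`. -/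
noncomputable def etaTranslate (N j : ℕ) : ℍ → ℂ :=
  fun τ ↦ eta (((τ : ℂ) + j) / N) ^ N / eta τ

theorem etaTranslate_zero (N : ℕ) : etaTranslate N 0 = etaLower N := by
  ext τ
  simp [etaTranslate, etaLower]

theorem etaTranslate_add_self (N j : ℕ) [NeZero N] (τ : ℍ) :
    etaTranslate N (j + N) τ = ζ₂₄ ^ N * etaTranslate N j τ := by
  have hN : (N : ℂ) ≠ 0 := NeZero.ne _
  have : ((τ : ℂ) + ((j + N : ℕ) : ℂ)) / N = (τ + j) / N + 1 := by
    push_cast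
    field_simp
    ring
  rw [etaTranslate, etaTranslate, this, eta_add_one]
  ring

theorem etaTranslate_vadd (N j : ℕ) (τ : ℍ) :
    etaTranslate N j ((1 : ℝ) +ᵥ τ) = ζ₂₄⁻¹ * etaTranslate N (j + 1) τ := by
  have h1 : (((1 : ℝ) +ᵥ τ : ℍ) : ℂ) = τ + 1 := by rw [coe_vadd]; push_cast; ring
  rw [etaTranslate, etaTranslate, h1, eta_add_one]
  push_cast
  rw [show (τ : ℂ) + 1 + j = τ + (j + 1) by ring]
  field_simp

theorem etaUpper_vadd (N : ℕ) (τ : ℍ) :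
    etaUpper N ((1 : ℝ) +ᵥ τ) = ζ₂₄⁻¹ * ζ₂₄ ^ (N * N) * etaUpper N τ := by
  have h1 : (((1 : ℝ) +ᵥ τ : ℍ) : ℂ) = τ + 1 := by rw [coe_vadd]; push_cast; ring
  rw [etaUpper, etaUpper, h1, eta_add_one, mul_add, mul_one, eta_add_natCast, mul_pow, ← pow_mul]
  field_simp

theorem etaUpper_S_smul (N : ℕ) [NeZero N] (τ : ℍ) :
    ζ₂₄ ^ (3 * N) * etaUpper N (S • τ) * Complex.sqrt τ =
      ζ₂₄ ^ 3 * Complex.sqrt ((τ : ℂ) / N) ^ N * etaLower N τ := by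
  have hN : (N : ℂ) ≠ 0 := NeZero.ne _
  have him : 0 < ((τ : ℂ) / N).im := by
    rw [Complex.div_natCast_im]
    exact div_pos τ.im_pos (mod_cast Nat.pos_of_neZero N)
  have h1 := eta_neg_one_div him
  have h2 := eta_neg_one_div τ.im_pos
  have h3 : (N : ℂ) * (-1 / τ) = -1 / (τ / N) := by field_simp
  have h4 : eta (-1 / (τ : ℂ)) ≠ 0 := by
    rw [← coe_S_smul]; exact eta_coe_ne_zero _
  rw [etaUpper, etaLower, coe_S_smul, h3]
  have h5 := eta_coe_ne_zero τ
  generalize eta (-1 / (τ / N : ℂ)) = A at *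
  generalize eta (-1 / (τ : ℂ)) = B at *
  field_simp
  rw [pow_mul, ← mul_pow, h1, mul_pow]
  linear_combination -(Complex.sqrt (τ / N) ^ N * eta (τ / N) ^ N) * h2

theorem etaTranslate_one_S_smul (N : ℕ) [NeZero N] (τ : ℍ) :
    ζ₂₄ ^ ((N + 1) * N) * etaTranslate N 1 (S • τ) * Complex.sqrt τ =
      ζ₂₄ ^ 3 * Complex.sqrt τ ^ N * etaTranslate N (N - 1) τ := by
  have h1 := eta_one_add_neg_one_div_div N τ
  have h2 := eta_neg_one_div τ.im_pos
  have h4 : eta (-1 / (τ : ℂ)) ≠ 0 := by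
    rw [← coe_S_smul]; exact eta_coe_ne_zero _
  have h5 := eta_coe_ne_zero τ
  rw [etaTranslate, etaTranslate, coe_S_smul, Nat.cast_one, Nat.cast_pred (Nat.pos_of_neZero N)]
  generalize eta ((-1 / (τ : ℂ) + 1) / N) = A at *
  generalize eta (-1 / (τ : ℂ)) = B at *
  field_simp
  rw [pow_mul, ← mul_pow, h1, mul_pow]
  linear_combination -(Complex.sqrt τ ^ N * eta ((τ + (N - 1)) / N) ^ N) * h2

theorem sqrt_div_three (τ : ℍ) :
    Complex.sqrt ((τ : ℂ) / 3) = (Real.sqrt (1 / 3) : ℂ) * Complex.sqrt τ := by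
  have h0 : (0 : ℝ) < Real.sqrt (1 / 3) := Real.sqrt_pos.mpr (by norm_num)
  have h1 := (sqrt_re_pos_im_pos (z := (τ : ℂ) / 3) (by
    simpa using τ.im_pos)).1
  have h2 := (sqrt_re_pos_im_pos τ.im_pos).1
  have hsq : Complex.sqrt ((τ : ℂ) / 3) ^ 2 = ((Real.sqrt (1 / 3) : ℂ) * Complex.sqrt τ) ^ 2 := by
    rw [mul_pow, sqrt_sq', sqrt_sq', ← Complex.ofReal_pow, Real.sq_sqrt (by norm_num)]
    push_cast
    ring
  refine (sq_eq_sq_iff_eq_or_eq_neg.mp hsq).resolve_right fun h ↦ ?_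
  have := congrArg Complex.re h
  simp only [Complex.neg_re, Complex.re_ofReal_mul] at this
  nlinarith [mul_pos h0 h2]

/-! ### Behaviour at `i∞` -/

/-- The Euler product is holomorphic in q near 0, where it equals 1. -/
theorem tendsto_tprod_one_sub_eta_q {a : ℝ} (ha : 0 < a) (b : ℝ) :
    Tendsto (fun τ : ℍ ↦ ∏' n, (1 - eta_q n (a * (τ : ℂ) + b))) atImInfty (𝓝 1) := by
  have h1 : Tendsto (fun q : ℂ ↦ ∏' n : ℕ, (1 - q ^ (n + 1))) (𝓝 0) (𝓝 1) := by
    have := (ModularForm.differentiableOn_tprod_one_sub_pow.differentiableAt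
      (Metric.isOpen_ball.mem_nhds (Metric.mem_ball_self one_pos))).continuousAt.tendsto
    simpa using this
  have h2 : Tendsto (fun τ : ℍ ↦ Function.Periodic.qParam 1 (a * (τ : ℂ) + b)) atImInfty (𝓝 0) := by
    have h3 : Tendsto (fun τ : ℍ ↦ a * (τ : ℂ) + b) atImInfty (comap Complex.im atTop) := by
      rw [tendsto_comap_iff]
      have : Tendsto (fun τ : ℍ ↦ a * τ.im) atImInfty atTop :=
        tendsto_comap.const_mul_atTop ha
      exact this.congr fun τ ↦ by simp
    exact ((Function.Periodic.qParam_tendsto one_pos).mono_right nhdsWithin_le_nhds).comp h3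
  exact h1.comp h2

/-- The leading powers q^(1/24) of numerator and denominator cancel; the translation by `j` leaves
the root of unity. -/
theorem tendsto_etaTranslate (N j : ℕ) [NeZero N] :
    Tendsto (etaTranslate N j) atImInfty (𝓝 (ζ₂₄ ^ j)) := by
  have hN : (0 : ℝ) < N := mod_cast Nat.pos_of_neZero N
  have hN' : (N : ℂ) ≠ 0 := NeZero.ne _
  have h1 := tendsto_tprod_one_sub_eta_q (inv_pos.mpr hN) (j / N)
  have h2 := tendsto_tprod_one_sub_eta_q one_pos 0
  have h3 := ((h1.pow N).div h2 one_ne_zero).const_mul (ζ₂₄ ^ j)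
  rw [one_pow, div_one, mul_one] at h3
  refine h3.congr fun τ ↦ ?_
  have e1 : ((N : ℝ)⁻¹ : ℝ) * (τ : ℂ) + ((j / N : ℝ) : ℂ) = (τ + j) / N := by
    push_cast; field_simp
  have e2 : ((1 : ℝ) : ℂ) * (τ : ℂ) + ((0 : ℝ) : ℂ) = τ := by simp
  simp only [Pi.div_apply, e1, e2]
  have h4 : Function.Periodic.qParam 24 ((τ + j) / N) ^ N =
      ζ₂₄ ^ j * Function.Periodic.qParam 24 τ := by
    rw [Function.Periodic.qParam, Function.Periodic.qParam, zetaTwentyFour, ← Complex.exp_nat_mul,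
      ← Complex.exp_nat_mul, ← Complex.exp_add]
    congr 1
    push_cast
    field_simp
    ring
  have h5 : Function.Periodic.qParam 24 (τ : ℂ) ≠ 0 := Function.Periodic.qParam_ne_zero _
  rw [etaTranslate, eta, eta, mul_pow, h4]
  field_simp

theorem tendsto_etaUpper (N : ℕ) [NeZero N] :
    Tendsto (fun τ : ℍ ↦ etaUpper N τ / Complex.exp (2 * π * Complex.I * (N ^ 2 - 1) / 24 * τ))
      atImInfty (𝓝 1) := by
  have hN : (0 : ℝ) < N := mod_cast Nat.pos_of_neZero N
  have h1 := tendsto_tprod_one_sub_eta_q hN 0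
  have h2 := tendsto_tprod_one_sub_eta_q one_pos 0
  have h3 := (h1.pow N).div h2 one_ne_zero
  rw [one_pow, div_one] at h3
  refine h3.congr fun τ ↦ ?_
  simp only [Pi.div_apply, Complex.ofReal_natCast, Complex.ofReal_one, one_mul, Complex.ofReal_zero,
    add_zero]
  have h4 : Function.Periodic.qParam 24 (N * τ : ℂ) ^ N =
      Complex.exp (2 * π * Complex.I * (N ^ 2 - 1) / 24 * τ) * Function.Periodic.qParam 24 τ := by
    rw [Function.Periodic.qParam, Function.Periodic.qParam, ← Complex.exp_nat_mul,
      ← Complex.exp_add]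
    congr 1
    push_cast
    ring
  have h5 : Function.Periodic.qParam 24 (τ : ℂ) ≠ 0 := Function.Periodic.qParam_ne_zero _
  have h6 := Complex.exp_ne_zero (2 * π * Complex.I * (N ^ 2 - 1) / 24 * τ)
  rw [etaUpper, eta, eta, mul_pow, h4]
  field_simp

/-- The leading exponent is e(N² - 1)/24. The numerical hypothesis makes it 1/N, a simple zero at
i∞; it holds for (N, e) = (2, 4) and (3, 1). -/
theorem tendsto_etaUpper_pow_div (N e : ℕ) [NeZero N] (h : (N : ℂ) * e * (N ^ 2 - 1) = 24) :
    Tendsto (fun τ : ℍ ↦ (etaUpper N ^ e) τ / Complex.exp (2 * π * Complex.I / N * τ))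
      atImInfty (𝓝 1) := by
  have hN' : (N : ℂ) ≠ 0 := NeZero.ne _
  have := (tendsto_etaUpper N).pow e
  rw [one_pow] at this
  refine this.congr fun τ ↦ ?_
  rw [div_pow, ← Complex.exp_nat_mul, Pi.pow_apply]
  congr 2
  rw [← h]
  have h0 : (e : ℂ) * (N ^ 2 - 1) ≠ 0 := by
    intro h0
    rw [mul_assoc, h0, mul_zero] at h
    norm_num at h
  have h1 := left_ne_zero_of_mul h0
  have h2 := right_ne_zero_of_mul h0
  field_simp

theorem norm_exp_two_pi_I_div (N : ℕ) (τ : ℍ) :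
    ‖Complex.exp (2 * π * Complex.I / N * τ)‖ = Real.exp (-2 * π * τ.im / N) := by
  rw [show 2 * π * Complex.I / N * τ = ((2 * π / N : ℝ) : ℂ) * (τ * Complex.I) by push_cast; ring,
    Complex.norm_exp, Complex.re_ofReal_mul]
  congr 1
  simp
  ring

theorem isBigO_exp_etaUpper_pow (N e : ℕ) [NeZero N] (h : (N : ℂ) * e * (N ^ 2 - 1) = 24) :
    (fun τ : ℍ ↦ Real.exp (-2 * π * τ.im / N)) =O[atImInfty] (etaUpper N ^ e) := by
  have h1 := (tendsto_etaUpper_pow_div N e h).inv₀ one_ne_zero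
  have h2 : (fun τ : ℍ ↦ Complex.exp (2 * π * Complex.I / N * τ)) =O[atImInfty]
      (etaUpper N ^ e) := by
    refine (((h1.isBigO_one ℂ).mul (Asymptotics.isBigO_refl (etaUpper N ^ e) _)).congr_left
      (fun τ ↦ ?_)).trans (by simpa using! Asymptotics.isBigO_refl _ _)
    have : (etaUpper N ^ e) τ ≠ 0 := by
      refine pow_ne_zero _ (div_ne_zero (pow_ne_zero _ (ModularForm.eta_ne_zero ?_))
        (eta_coe_ne_zero τ))
      simpa [UpperHalfPlane.upperHalfPlaneSet] using mul_pos
        (mod_cast Nat.pos_of_neZero N : (0 : ℝ) < N) τ.im_pos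
    field_simp
  refine h2.norm_left.congr_left fun τ ↦ norm_exp_two_pi_I_div N τ

theorem tendsto_etaUpper_pow_zero (N e : ℕ) [NeZero N] (h : (N : ℂ) * e * (N ^ 2 - 1) = 24) :
    Tendsto (etaUpper N ^ e) atImInfty (𝓝 0) := by
  have hN : (0 : ℝ) < N := mod_cast Nat.pos_of_neZero N
  have h1 := (tendsto_etaUpper_pow_div N e h).mul (qParam_tendsto_atImInfty hN)
  rw [mul_zero] at h1
  refine h1.congr fun τ ↦ ?_
  rw [Function.Periodic.qParam, show 2 * π * Complex.I * τ / ((N : ℝ) : ℂ) =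
    2 * π * Complex.I / N * τ by push_cast; ring, div_mul_cancel₀ _ (Complex.exp_ne_zero _)]

end Eta

/-! ### The orbits of the eta quotients under S and T -/

section EtaOrbit

open ModularForm (eta)

local notation "ζ₂₄" => zetaTwentyFour

theorem map_mul_S_apply {N : ℕ} (g : SL(2, ZMod N)) :
    let h := g * Matrix.SpecialLinearGroup.map (Int.castRingHom (ZMod N)) S
    h 0 0 = g 0 1 ∧ h 0 1 = -g 0 0 ∧ h 1 0 = g 1 1 ∧ h 1 1 = -g 1 0 := by
  have hm (γ : SL(2, ℤ)) (i j : Fin 2) :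
      Matrix.SpecialLinearGroup.map (Int.castRingHom (ZMod N)) γ i j = (γ i j : ZMod N) := rfl
  simp only [Matrix.SpecialLinearGroup.coe_mul, Matrix.mul_apply, Fin.sum_univ_two, hm]
  simp [S]

theorem map_mul_T_apply {N : ℕ} (g : SL(2, ZMod N)) :
    let h := g * Matrix.SpecialLinearGroup.map (Int.castRingHom (ZMod N)) T
    h 0 0 = g 0 0 ∧ h 0 1 = g 0 0 + g 0 1 ∧ h 1 0 = g 1 0 ∧ h 1 1 = g 1 0 + g 1 1 := by
  have hm (γ : SL(2, ℤ)) (i j : Fin 2) :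
      Matrix.SpecialLinearGroup.map (Int.castRingHom (ZMod N)) γ i j = (γ i j : ZMod N) := rfl
  simp only [Matrix.SpecialLinearGroup.coe_mul, Matrix.mul_apply, Fin.sum_univ_two, hm]
  simp [T]

theorem det_eq_one' {N : ℕ} (g : SL(2, ZMod N)) : g 0 0 * g 1 1 - g 0 1 * g 1 0 = 1 := by
  have := g.det_coe
  rwa [Matrix.det_fin_two] at this

/-- Exponents of the character of order `3` of `SL(2, ℤ/3)`. -/
def exponentThree (a b c d : ZMod 3) : ZMod 3 := (1 - c ^ 2) * b * d + c * (a + d)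

/-- Exponents of the sign character of `SL(2, ℤ/2)`. -/
def exponentTwo (a b c d : ZMod 2) : ZMod 2 := (1 - c) * b * d + c * (a + d + 1)

/-- Together with `exponentThree_T`: this character is trivial on S and has exponent 1 on T, which
absorbs the factor ζ₂₄^8 produced by T on the row functions. -/
theorem exponentThree_S : ∀ a b c d : ZMod 3, a * d - b * c = 1 →
    exponentThree b (-a) d (-c) = exponentThree a b c d := by decide

theorem exponentThree_T : ∀ a b c d : ZMod 3, a * d - b * c = 1 →
    exponentThree a (a + b) c (c + d) = exponentThree a b c d + 1 := by decide

/-- At level two both S and T multiply the row functions by -1, so the sign character is needed. -/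
theorem exponentTwo_S : ∀ a b c d : ZMod 2, a * d - b * c = 1 →
    exponentTwo b (-a) d (-c) = exponentTwo a b c d + 1 := by decide

theorem exponentTwo_T : ∀ a b c d : ZMod 2, a * d - b * c = 1 →
    exponentTwo a (a + b) c (c + d) = exponentTwo a b c d + 1 := by decide

/-! ### Level three -/

theorem etaUpper_three_slash_T : etaUpper 3 ∣[(1 : ℤ)] T = ζ₂₄ ^ 8 • etaUpper 3 := by
  ext τ
  rw [slash_T_apply, etaUpper_vadd, Pi.smul_apply, smul_eq_mul,
    show ζ₂₄ ^ (3 * 3) = ζ₂₄ * ζ₂₄ ^ 8 by ring, inv_mul_cancel_left₀ zetaTwentyFour_ne_zero]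

theorem etaTranslate_three_slash_T (j : ℕ) :
    etaTranslate 3 j ∣[(1 : ℤ)] T = ζ₂₄ ^ 23 • etaTranslate 3 (j + 1) := by
  ext τ
  rw [slash_T_apply, etaTranslate_vadd, Pi.smul_apply, smul_eq_mul]
  congr 1
  exact inv_eq_of_mul_eq_one_right (by rw [← pow_succ']; exact zetaTwentyFour_pow)

theorem etaTranslate_three_three : etaTranslate 3 3 = ζ₂₄ ^ 3 • etaTranslate 3 0 := by
  ext τ
  simpa using etaTranslate_add_self 3 0 τ

/-- The factor in `etaUpper 3 ∣ S`. -/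
noncomputable def kappaThree : ℂ := ζ₂₄ ^ 18 * (Real.sqrt (1 / 3) : ℂ) ^ 3

theorem kappaThree_ne_zero : kappaThree ≠ 0 :=
  mul_ne_zero (pow_ne_zero _ zetaTwentyFour_ne_zero) (pow_ne_zero _ (Complex.ofReal_ne_zero.mpr
    (Real.sqrt_pos.mpr (by norm_num)).ne'))

theorem sqrt_coe_ne_zero (τ : ℍ) : Complex.sqrt (τ : ℂ) ≠ 0 := by
  intro h
  have := sqrt_sq' (τ : ℂ)
  rw [h] at this
  exact τ.ne_zero (by simpa using this.symm)

theorem etaUpper_three_slash_S : etaUpper 3 ∣[(1 : ℤ)] S = kappaThree • etaTranslate 3 0 := by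
  ext τ
  have h := etaUpper_S_smul 3 τ
  have hs := sqrt_sq' (τ : ℂ)
  have hs0 := sqrt_coe_ne_zero τ
  have hz := zetaTwentyFour_ne_zero
  have h24 := zetaTwentyFour_pow
  rw [slash_S_apply, Pi.smul_apply, smul_eq_mul, kappaThree, etaTranslate_zero, zpow_neg, zpow_one,
    mul_inv_eq_iff_eq_mul₀ τ.ne_zero]
  rw [Nat.cast_ofNat, sqrt_div_three] at h
  refine mul_left_cancel₀ (mul_ne_zero (pow_ne_zero (3 * 3) hz) hs0) ?_
  linear_combination h - ζ₂₄ ^ 3 * (Real.sqrt (1 / 3) : ℂ) ^ 3 * Complex.sqrt τ * etaLower 3 τ *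
    (τ * h24 - hs)

theorem etaTranslate_one_slash_S :
    etaTranslate 3 1 ∣[(1 : ℤ)] S = ζ₂₄ ^ 15 • etaTranslate 3 2 := by
  ext τ
  have h := etaTranslate_one_S_smul 3 τ
  have hs := sqrt_sq' (τ : ℂ)
  have hs0 := sqrt_coe_ne_zero τ
  have hz := zetaTwentyFour_ne_zero
  have h12 := zetaTwentyFour_pow_twelve
  rw [slash_S_apply, Pi.smul_apply, smul_eq_mul, zpow_neg, zpow_one,
    mul_inv_eq_iff_eq_mul₀ τ.ne_zero]
  refine mul_left_cancel₀ (mul_ne_zero (pow_ne_zero 12 hz) hs0) ?_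
  grind

theorem etaTranslate_zero_slash_S :
    etaTranslate 3 0 ∣[(1 : ℤ)] S = (-kappaThree⁻¹) • etaUpper 3 := by
  have h := slash_S_slash_S (etaUpper 3) 1
  rw [etaUpper_three_slash_S, ModularForm.SL_smul_slash] at h
  rw [← inv_smul_smul₀ kappaThree_ne_zero (etaTranslate 3 0 ∣[(1 : ℤ)] S), h]
  simp

theorem etaTranslate_two_slash_S :
    etaTranslate 3 2 ∣[(1 : ℤ)] S = (ζ₂₄ ^ 21) • etaTranslate 3 1 := by
  have h := slash_S_slash_S (etaTranslate 3 1) 1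
  rw [etaTranslate_one_slash_S, ModularForm.SL_smul_slash] at h
  rw [← inv_smul_smul₀ (pow_ne_zero 15 zetaTwentyFour_ne_zero) (etaTranslate 3 2 ∣[(1 : ℤ)] S), h,
    smul_smul]
  congr 1
  have h12 := zetaTwentyFour_pow_twelve
  have hz := zetaTwentyFour_ne_zero
  rw [inv_mul_eq_iff_eq_mul₀ (pow_ne_zero 15 hz), zpow_one]
  grind

/-- The forms attached to the nonzero row vectors modulo `3`. -/
noncomputable def etaRowThree (c d : ZMod 3) : ℍ → ℂ :=
  if c = 0 then (if d = 1 then 1 else -1 : ℂ) • etaUpper 3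
  -- Weight one is odd, hence the sign under (c, d) ↦ (-c, -d). T takes translate j to ζ₂₄^23 times
  -- translate j + 1; splitting off the common factor ζ₂₄^8 leaves ζ₂₄^15 per step.
  else ((if c = 1 then 1 else -1) * kappaThree * ζ₂₄ ^ (15 * (c * d).val) : ℂ) •
    etaTranslate 3 (c * d).val

theorem etaRowThree_apply :
    etaRowThree 0 1 = etaUpper 3 ∧ etaRowThree 0 2 = (-1 : ℂ) • etaUpper 3 ∧
    etaRowThree 1 0 = kappaThree • etaTranslate 3 0 ∧
    etaRowThree 1 1 = (kappaThree * ζ₂₄ ^ 15) • etaTranslate 3 1 ∧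
    etaRowThree 1 2 = (kappaThree * ζ₂₄ ^ 30) • etaTranslate 3 2 ∧
    etaRowThree 2 0 = (-kappaThree) • etaTranslate 3 0 ∧
    etaRowThree 2 1 = (-kappaThree * ζ₂₄ ^ 30) • etaTranslate 3 2 ∧
    etaRowThree 2 2 = (-kappaThree * ζ₂₄ ^ 15) • etaTranslate 3 1 := by
  have h1 : (2 : ZMod 3) ≠ 0 := by decide
  have h2 : (2 : ZMod 3) ≠ 1 := by decide
  have h3 : (2 : ZMod 3).val = 2 := rfl
  have h4 : (2 * 2 : ZMod 3).val = 1 := rfl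
  have h5 : (1 : ZMod 3).val = 1 := rfl
  refine ⟨?_, ?_, ?_, ?_, ?_, ?_, ?_, ?_⟩ <;> simp [etaRowThree, h1, h2, h3, h4, h5]

theorem etaRowThree_slash_T (c d : ZMod 3) (h : c ≠ 0 ∨ d ≠ 0) :
    etaRowThree c d ∣[(1 : ℤ)] T = ζ₂₄ ^ 8 • etaRowThree c (c + d) := by
  have h12 := zetaTwentyFour_pow_twelve
  obtain ⟨r1, r2, r3, r4, r5, r6, r7, r8⟩ := etaRowThree_apply
  have all : ∀ x : ZMod 3, x = 0 ∨ x = 1 ∨ x = 2 := by decide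
  have s1 : (1 + 1 : ZMod 3) = 2 := rfl
  have s2 : (1 + 2 : ZMod 3) = 0 := rfl
  have s3 : (2 + 1 : ZMod 3) = 0 := rfl
  have s4 : (2 + 2 : ZMod 3) = 1 := rfl
  rcases all c with rfl | rfl | rfl <;> rcases all d with rfl | rfl | rfl
  · simp at h
  all_goals
    simp only [zero_add, add_zero, s1, s2, s3, s4, r1, r2, r3, r4, r5, r6, r7, r8,
      ModularForm.SL_smul_slash, etaUpper_three_slash_T, etaTranslate_three_slash_T,
      etaTranslate_three_three, smul_smul, Nat.reduceAdd]
    try congr 1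
    try grind

theorem etaRowThree_slash_S (c d : ZMod 3) (h : c ≠ 0 ∨ d ≠ 0) :
    etaRowThree c d ∣[(1 : ℤ)] S = etaRowThree d (-c) := by
  have h12 := zetaTwentyFour_pow_twelve
  have hk := kappaThree_ne_zero
  obtain ⟨r1, r2, r3, r4, r5, r6, r7, r8⟩ := etaRowThree_apply
  have all : ∀ x : ZMod 3, x = 0 ∨ x = 1 ∨ x = 2 := by decide
  have neg : ∀ x y : ZMod 3, y = -x → x = 0 ∧ y = 0 ∨ x = 1 ∧ y = 2 ∨ x = 2 ∧ y = 1 := by decide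
  generalize he : -c = e
  rcases neg c e he.symm with ⟨rfl, rfl⟩ | ⟨rfl, rfl⟩ | ⟨rfl, rfl⟩ <;>
    rcases all d with rfl | rfl | rfl
  · exact absurd rfl (h.resolve_left (not_not.mpr rfl))
  · rw [r1, r3, etaUpper_three_slash_S]
  · rw [r2, r6, ModularForm.SL_smul_slash, etaUpper_three_slash_S, smul_smul, neg_one_mul]
  · rw [r3, r2, ModularForm.SL_smul_slash, etaTranslate_zero_slash_S, smul_smul, mul_neg,
      mul_inv_cancel₀ hk]
  · rw [r4, r5, ModularForm.SL_smul_slash, etaTranslate_one_slash_S, smul_smul]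
    exact congrArg (fun c : ℂ ↦ c • etaTranslate 3 _) (by ring)
  · rw [r5, r8, ModularForm.SL_smul_slash, etaTranslate_two_slash_S, smul_smul]
    exact congrArg (fun c : ℂ ↦ c • etaTranslate 3 _) (by grind)
  · rw [r6, r1, ModularForm.SL_smul_slash, etaTranslate_zero_slash_S, smul_smul, neg_mul_neg,
      mul_inv_cancel₀ hk, one_smul]
  · rw [r7, r4, ModularForm.SL_smul_slash, etaTranslate_two_slash_S, smul_smul]
    exact congrArg (fun c : ℂ ↦ c • etaTranslate 3 _) (by grind)
  · rw [r8, r7, ModularForm.SL_smul_slash, etaTranslate_one_slash_S, smul_smul]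
    exact congrArg (fun c : ℂ ↦ c • etaTranslate 3 _) (by ring)

/-- The orbit of `η(3τ) ^ 3 / η(τ)` under `SL(2, ℤ)`. -/
noncomputable def etaOrbitThree (g : SL(2, ZMod 3)) : ℍ → ℂ :=
  ((ζ₂₄ ^ 8) ^ (exponentThree (g 0 0) (g 0 1) (g 1 0) (g 1 1)).val) • etaRowThree (g 1 0) (g 1 1)

theorem row_ne_zero {N : ℕ} [Fact (1 < N)] (g : SL(2, ZMod N)) : g 1 0 ≠ 0 ∨ g 1 1 ≠ 0 := by
  by_contra! h
  simpa [h.1, h.2] using det_eq_one' g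

theorem isSlashOrbit_etaOrbitThree : IsSlashOrbit 1 etaOrbitThree where
  slash_S g := by
    obtain ⟨h1, h2, h3, h4⟩ := map_mul_S_apply g
    have : Fact (1 < 3) := ⟨by norm_num⟩
    rw [etaOrbitThree, etaOrbitThree, h1, h2, h3, h4, exponentThree_S _ _ _ _ (det_eq_one' g),
      ModularForm.SL_smul_slash, etaRowThree_slash_S _ _ (row_ne_zero g)]
  slash_T g := by
    obtain ⟨h1, h2, h3, h4⟩ := map_mul_T_apply g
    have : Fact (1 < 3) := ⟨by norm_num⟩
    rw [etaOrbitThree, etaOrbitThree, h1, h2, h3, h4, exponentThree_T _ _ _ _ (det_eq_one' g),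
      ModularForm.SL_smul_slash, etaRowThree_slash_T _ _ (row_ne_zero g), smul_smul]
    congr 1
    have h24 := zetaTwentyFour_pow
    have : ∀ x : ZMod 3, (x + 1).val = x.val + 1 ∨ (x.val = 2 ∧ (x + 1).val = 0) := by decide
    rcases this (exponentThree (g 0 0) (g 0 1) (g 1 0) (g 1 1)) with h | ⟨h, h'⟩
    · rw [h, pow_succ (ζ₂₄ ^ 8), mul_comm]
    · rw [h, h']; grind

theorem etaOrbitThree_one : etaOrbitThree 1 = etaUpper 3 := by
  have h : exponentThree 1 0 0 1 = 0 := rfl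
  simp [etaOrbitThree, etaRowThree, h]

/-! ### Level two -/

theorem etaUpper_two_slash_T : (etaUpper 2 ^ 4) ∣[(2 : ℤ)] T = (-1 : ℂ) • etaUpper 2 ^ 4 := by
  ext τ
  have hz := zetaTwentyFour_ne_zero
  have h12 := zetaTwentyFour_pow_twelve
  rw [slash_T_apply, Pi.pow_apply, etaUpper_vadd, Pi.smul_apply, smul_eq_mul, Pi.pow_apply, mul_pow,
    show ζ₂₄⁻¹ * ζ₂₄ ^ (2 * 2) = ζ₂₄ ^ 3 by field_simp, ← pow_mul, h12]

theorem etaTranslate_two_slash_T (j : ℕ) :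
    (etaTranslate 2 j ^ 4) ∣[(2 : ℤ)] T = ζ₂₄ ^ 20 • etaTranslate 2 (j + 1) ^ 4 := by
  ext τ
  have hz := zetaTwentyFour_ne_zero
  have h24 := zetaTwentyFour_pow
  rw [slash_T_apply, Pi.pow_apply, etaTranslate_vadd, Pi.smul_apply, smul_eq_mul, Pi.pow_apply,
    mul_pow]
  congr 1
  rw [inv_pow]
  refine inv_eq_of_mul_eq_one_right ?_
  rw [← pow_add, h24]

theorem etaTranslate_two_two : etaTranslate 2 2 ^ 4 = ζ₂₄ ^ 8 • etaTranslate 2 0 ^ 4 := by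
  ext τ
  have := etaTranslate_add_self 2 0 τ
  rw [zero_add] at this
  rw [Pi.pow_apply, this, Pi.smul_apply, smul_eq_mul, Pi.pow_apply, mul_pow, ← pow_mul]

theorem etaUpper_two_slash_S :
    (etaUpper 2 ^ 4) ∣[(2 : ℤ)] S = (-(1 / 16) : ℂ) • etaTranslate 2 0 ^ 4 := by
  ext τ
  have h := congrArg (· ^ 4) (etaUpper_S_smul 2 τ)
  have hs := sqrt_sq' (τ : ℂ)
  have hs' := sqrt_sq' (τ / 2 : ℂ)
  have hz := zetaTwentyFour_ne_zero
  have h12 := zetaTwentyFour_pow_twelve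
  rw [slash_S_apply, Pi.smul_apply, smul_eq_mul, Pi.pow_apply, Pi.pow_apply, etaTranslate_zero,
    zpow_neg, mul_inv_eq_iff_eq_mul₀ (zpow_ne_zero _ τ.ne_zero)]
  simp only [Nat.cast_ofNat, hs', mul_pow, ← pow_mul] at h
  rw [show Complex.sqrt τ ^ 4 = (Complex.sqrt τ ^ 2) ^ 2 by ring, hs] at h
  norm_num at h ⊢
  rw [zetaTwentyFour_pow, h12] at h
  refine mul_right_cancel₀ (pow_ne_zero 2 τ.ne_zero) ?_
  linear_combination h

theorem etaTranslate_two_one_slash_S :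
    (etaTranslate 2 1 ^ 4) ∣[(2 : ℤ)] S = (-1 : ℂ) • etaTranslate 2 1 ^ 4 := by
  ext τ
  have h := congrArg (· ^ 4) (etaTranslate_one_S_smul 2 τ)
  have hs := sqrt_sq' (τ : ℂ)
  have h12 := zetaTwentyFour_pow_twelve
  rw [slash_S_apply, Pi.smul_apply, smul_eq_mul, Pi.pow_apply, Pi.pow_apply,
    zpow_neg, mul_inv_eq_iff_eq_mul₀ (zpow_ne_zero _ τ.ne_zero)]
  simp only [hs, mul_pow, ← pow_mul] at h
  rw [show Complex.sqrt τ ^ 4 = (Complex.sqrt τ ^ 2) ^ 2 by ring, hs] at h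
  norm_num at h ⊢
  rw [zetaTwentyFour_pow, h12] at h
  refine mul_right_cancel₀ (pow_ne_zero 2 τ.ne_zero) ?_
  linear_combination h

theorem etaTranslate_two_zero_slash_S :
    (etaTranslate 2 0 ^ 4) ∣[(2 : ℤ)] S = (-16 : ℂ) • etaUpper 2 ^ 4 := by
  have h := slash_S_slash_S (etaUpper 2 ^ 4) 2
  rw [etaUpper_two_slash_S, ModularForm.SL_smul_slash] at h
  rw [← inv_smul_smul₀ (show (-(1 / 16) : ℂ) ≠ 0 by norm_num) ((etaTranslate 2 0 ^ 4) ∣[(2 : ℤ)] S),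
    h, smul_smul]
  exact congrArg (fun c : ℂ ↦ c • etaUpper 2 ^ 4) (by norm_num)

/-- The forms attached to the nonzero row vectors modulo `2`. -/
noncomputable def etaRowTwo (c d : ZMod 2) : ℍ → ℂ :=
  -- Here T contributes ζ₂₄^20 = -ζ₂₄^8 per translate, and 1/16 comes from the action of S on
  -- `etaUpper 2 ^ 4`.
  if c = 0 then etaUpper 2 ^ 4 else (1 / 16 * (ζ₂₄ ^ 8) ^ d.val : ℂ) • etaTranslate 2 d.val ^ 4

theorem etaRowTwo_apply :
    etaRowTwo 0 1 = etaUpper 2 ^ 4 ∧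
    etaRowTwo 1 0 = (1 / 16 : ℂ) • etaTranslate 2 0 ^ 4 ∧
    etaRowTwo 1 1 = (1 / 16 * ζ₂₄ ^ 8 : ℂ) • etaTranslate 2 1 ^ 4 := by
  have h5 : (1 : ZMod 2).val = 1 := rfl
  refine ⟨?_, ?_, ?_⟩ <;> simp [etaRowTwo, h5]

theorem etaRowTwo_slash_T (c d : ZMod 2) (h : c ≠ 0 ∨ d ≠ 0) :
    etaRowTwo c d ∣[(2 : ℤ)] T = (-1 : ℂ) • etaRowTwo c (c + d) := by
  have h12 := zetaTwentyFour_pow_twelve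
  obtain ⟨r1, r2, r3⟩ := etaRowTwo_apply
  have all : ∀ x : ZMod 2, x = 0 ∨ x = 1 := by decide
  have s1 : (1 + 1 : ZMod 2) = 0 := rfl
  rcases all c with rfl | rfl <;> rcases all d with rfl | rfl
  · simp at h
  · rw [zero_add, r1, etaUpper_two_slash_T]
  · rw [add_zero, r2, r3, ModularForm.SL_smul_slash, etaTranslate_two_slash_T, smul_smul, smul_smul]
    exact congrArg (fun c : ℂ ↦ c • etaTranslate 2 1 ^ 4) (by grind)
  · rw [s1, r2, r3, ModularForm.SL_smul_slash, etaTranslate_two_slash_T, etaTranslate_two_two,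
      smul_smul, smul_smul, smul_smul]
    exact congrArg (fun c : ℂ ↦ c • etaTranslate 2 0 ^ 4) (by grind)

theorem etaRowTwo_slash_S (c d : ZMod 2) (h : c ≠ 0 ∨ d ≠ 0) :
    etaRowTwo c d ∣[(2 : ℤ)] S = (-1 : ℂ) • etaRowTwo d (-c) := by
  obtain ⟨r1, r2, r3⟩ := etaRowTwo_apply
  have all : ∀ x : ZMod 2, x = 0 ∨ x = 1 := by decide
  have s1 : (-1 : ZMod 2) = 1 := rfl
  rcases all c with rfl | rfl <;> rcases all d with rfl | rfl
  · simp at h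
  · rw [neg_zero, r1, r2, etaUpper_two_slash_S, smul_smul, neg_one_mul]
  · rw [s1, r1, r2, ModularForm.SL_smul_slash, etaTranslate_two_zero_slash_S, smul_smul]
    exact congrArg (fun c : ℂ ↦ c • etaUpper 2 ^ 4) (by norm_num)
  · rw [s1, r3, ModularForm.SL_smul_slash, etaTranslate_two_one_slash_S, smul_smul, smul_smul,
      mul_comm]

/-- The orbit of `(η(2τ) ^ 2 / η(τ)) ^ 4` under `SL(2, ℤ)`. -/
noncomputable def etaOrbitTwo (g : SL(2, ZMod 2)) : ℍ → ℂ :=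
  ((-1 : ℂ) ^ (exponentTwo (g 0 0) (g 0 1) (g 1 0) (g 1 1)).val) • etaRowTwo (g 1 0) (g 1 1)

theorem neg_one_pow_zmod_two_val_add_one (x : ZMod 2) :
    (-1 : ℂ) ^ (x + 1).val * (-1) = (-1) ^ x.val ∧
      (-1 : ℂ) ^ x.val * (-1) = (-1) ^ (x + 1).val := by
  have : ∀ x : ZMod 2, (x.val = 0 ∧ (x + 1).val = 1) ∨ (x.val = 1 ∧ (x + 1).val = 0) := by decide
  rcases this x with ⟨h, h'⟩ | ⟨h, h'⟩ <;> rw [h, h'] <;> norm_num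

theorem isSlashOrbit_etaOrbitTwo : IsSlashOrbit 2 etaOrbitTwo where
  slash_S g := by
    obtain ⟨h1, h2, h3, h4⟩ := map_mul_S_apply g
    have : Fact (1 < 2) := ⟨by norm_num⟩
    rw [etaOrbitTwo, etaOrbitTwo, h1, h2, h3, h4, exponentTwo_S _ _ _ _ (det_eq_one' g),
      ModularForm.SL_smul_slash, etaRowTwo_slash_S _ _ (row_ne_zero g), smul_smul,
      (neg_one_pow_zmod_two_val_add_one _).2]
  slash_T g := by
    obtain ⟨h1, h2, h3, h4⟩ := map_mul_T_apply g
    have : Fact (1 < 2) := ⟨by norm_num⟩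
    rw [etaOrbitTwo, etaOrbitTwo, h1, h2, h3, h4, exponentTwo_T _ _ _ _ (det_eq_one' g),
      ModularForm.SL_smul_slash, etaRowTwo_slash_T _ _ (row_ne_zero g), smul_smul,
      (neg_one_pow_zmod_two_val_add_one _).2]

theorem etaOrbitTwo_one : etaOrbitTwo 1 = etaUpper 2 ^ 4 := by
  have h : exponentTwo 1 0 0 1 = 0 := rfl
  simp [etaOrbitTwo, etaRowTwo, h]

end EtaOrbit

/-! ### Division by the upper eta quotient at levels two and three -/

section EtaForms

open ModularForm (eta)

local notation "ζ₂₄" => zetaTwentyFour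

theorem im_natCast_mul_pos (N : ℕ) [NeZero N] {z : ℂ} (hz : 0 < z.im) : 0 < ((N : ℂ) * z).im := by
  simpa using mul_pos (mod_cast Nat.pos_of_neZero N : (0 : ℝ) < N) hz

theorem mdifferentiable_etaUpper (N : ℕ) [NeZero N] : MDiff (etaUpper N) := by
  rw [UpperHalfPlane.mdifferentiable_iff]
  have h : DifferentiableOn ℂ (fun z : ℂ ↦ eta (N * z) ^ N / eta z) {z | 0 < z.im} := by
    intro z hz
    have h1 := ModularForm.differentiableAt_eta_of_mem_upperHalfPlaneSet hz
    have h2 := (ModularForm.differentiableAt_eta_of_mem_upperHalfPlaneSet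
      (im_natCast_mul_pos N hz)).comp z (differentiableAt_id.const_mul (N : ℂ))
    exact ((h2.pow N).div h1 (ModularForm.eta_ne_zero hz)).differentiableWithinAt
  refine h.congr fun z hz ↦ ?_
  rw [Function.comp_apply, etaUpper, ofComplex_apply_of_im_pos hz, coe_mk]

theorem etaUpper_ne_zero (N : ℕ) [NeZero N] (τ : ℍ) : etaUpper N τ ≠ 0 :=
  div_ne_zero (pow_ne_zero _ (ModularForm.eta_ne_zero (im_natCast_mul_pos N τ.im_pos)))
    (eta_coe_ne_zero τ)

theorem tendsto_smul {f : ℍ → ℂ} {l : Filter ℍ} {a : ℂ} (h : Tendsto f l (𝓝 a)) (c : ℂ) :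
    Tendsto (c • f) l (𝓝 (c * a)) :=
  h.const_mul c

theorem etaOrbitThree_tendsto (g : SL(2, ZMod 3)) (hg : g 1 0 ≠ 0) :
    ∃ c : ℂ, c ≠ 0 ∧ Tendsto (etaOrbitThree g) atImInfty (𝓝 c) := by
  rw [etaOrbitThree, etaRowThree, if_neg hg, smul_smul]
  have h0 := zetaTwentyFour_ne_zero
  have hk := kappaThree_ne_zero
  refine ⟨_, ?_, tendsto_smul (tendsto_etaTranslate 3 _) _⟩
  refine mul_ne_zero (mul_ne_zero (pow_ne_zero _ (pow_ne_zero _ h0)) (mul_ne_zero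
    (mul_ne_zero ?_ hk) (pow_ne_zero _ h0))) (pow_ne_zero _ h0)
  split_ifs <;> norm_num

theorem etaOrbitThree_eq_smul (g : SL(2, ZMod 3)) (hg : g 1 0 = 0) :
    ∃ c : ℂ, c ≠ 0 ∧ etaOrbitThree g = c • (etaUpper 3 ^ 1) := by
  rw [etaOrbitThree, etaRowThree, if_pos hg, smul_smul, pow_one]
  refine ⟨_, mul_ne_zero (pow_ne_zero _ (pow_ne_zero _ zetaTwentyFour_ne_zero)) ?_, rfl⟩
  split_ifs <;> norm_num

theorem etaOrbitTwo_tendsto (g : SL(2, ZMod 2)) (hg : g 1 0 ≠ 0) :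
    ∃ c : ℂ, c ≠ 0 ∧ Tendsto (etaOrbitTwo g) atImInfty (𝓝 c) := by
  rw [etaOrbitTwo, etaRowTwo, if_neg hg, smul_smul]
  have h0 := zetaTwentyFour_ne_zero
  refine ⟨_, ?_, tendsto_smul ((tendsto_etaTranslate 2 _).pow 4) _⟩
  exact mul_ne_zero (mul_ne_zero (pow_ne_zero _ (by norm_num)) (mul_ne_zero (by norm_num)
    (pow_ne_zero _ (pow_ne_zero _ h0)))) (pow_ne_zero _ (pow_ne_zero _ h0))

theorem etaOrbitTwo_eq_smul (g : SL(2, ZMod 2)) (hg : g 1 0 = 0) :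
    ∃ c : ℂ, c ≠ 0 ∧ etaOrbitTwo g = c • (etaUpper 2 ^ 4) := by
  rw [etaOrbitTwo, etaRowTwo, if_pos hg]
  exact ⟨_, pow_ne_zero _ (by norm_num), rfl⟩

/-- If an orbit consists of multiples of `etaUpper N ^ e` and of functions with nonzero limits, then
the eta quotients `etaLower N ^ e` and `etaUpper N ^ e` are forms, and division holds. -/
theorem exists_hasDivision_eta {N e w : ℕ} [NeZero N] (hN : (N : ℂ) * e * (N ^ 2 - 1) = 24)
    (hw : 0 < w) {F : SL(2, ZMod N) → ℍ → ℂ} (h : IsSlashOrbit (w : ℤ) F)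
    (h1 : F 1 = etaUpper N ^ e) {c : ℂ} (hc : c ≠ 0)
    (hS : (etaUpper N ^ e) ∣[(w : ℤ)] S = c • (etaLower N ^ e))
    (hrow : ∀ g : SL(2, ZMod N), g 1 0 = 0 → g 1 1 = 1 ∨ g 1 1 = -1)
    (hcusp : ∀ g, g 1 0 ≠ 0 → ∃ c : ℂ, c ≠ 0 ∧ Tendsto (F g) atImInfty (𝓝 c))
    (hinf : ∀ g, g 1 0 = 0 → ∃ c : ℂ, c ≠ 0 ∧ F g = c • (etaUpper N ^ e))
    (hzero : ∀ k, ¬ w ∣ k → ∀ g ∈ modularForms Γ(N) k, g = 0) :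
    ∃ x y : modularForms Γ(N) w, (x : ℍ → ℂ) = etaLower N ^ e ∧ (y : ℍ → ℂ) = etaUpper N ^ e ∧
      HasDivision Γ(N) x y := by
  have hdiff : MDiff (F 1) := by
    rw [h1]
    exact (mdifferentiable_etaUpper N).pow e
  have hy0 := tendsto_etaUpper_pow_zero N e hN
  have hF : F 1 ∈ modularForms Γ(N) w := by
    refine h.mem_modularForms hdiff fun g ↦ ?_
    by_cases hg : g 1 0 = 0
    · obtain ⟨c, -, hc⟩ := hinf g hg
      rw [hc]
      exact (hy0.const_smul c).isBigO_one ℝ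
    · obtain ⟨c, -, hc⟩ := hcusp g hg
      exact hc.isBigO_one ℝ
  -- Up to a scalar the lower quotient is the slash of the upper one by S, and Γ(N) is normal.
  have hG : etaLower N ^ e ∈ modularForms Γ(N) w := by
    have := (modularForms Γ(N) w).smul_mem c⁻¹ (slash_mem_modularForms_Gamma hF S)
    rwa [h1, hS, inv_smul_smul₀ hc] at this
  refine ⟨⟨_, hG⟩, ⟨_, hF⟩, rfl, h1, h.hasDivision hw rfl hrow hcusp (fun g hg ↦ ?_) ?_ ?_ ?_ hzero⟩
  · obtain ⟨c, hc0, hc⟩ := hinf g hg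
    rw [hc]
    exact (isBigO_exp_etaUpper_pow N e hN).trans ((Asymptotics.isBigO_refl _ _).const_mul_right'
      (isUnit_iff_ne_zero.mpr hc0))
  · intro τ
    rw [h1]
    exact pow_ne_zero _ (etaUpper_ne_zero N τ)
  · have := (tendsto_etaTranslate N 0).pow e
    rwa [pow_zero, one_pow, etaTranslate_zero] at this
  · rwa [h1]

/-- -1 lies in Γ(2) and acts by -1 in odd weight. -/
theorem modularForms_Gamma_two_eq_zero {k : ℕ} (hk : ¬ 2 ∣ k) {g : ℍ → ℂ}
    (hg : g ∈ modularForms Γ(2) k) : g = 0 := by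
  obtain ⟨f, rfl⟩ := hg
  have h1 : (-1 : SL(2, ℤ)) ∈ CongruenceSubgroup.Gamma 2 := by
    rw [CongruenceSubgroup.Gamma_mem]
    simp
  have h2 : (-1 : GL (Fin 2) ℝ) ∈ (Γ(2) : Subgroup (GL (Fin 2) ℝ)) := ⟨-1, h1, by ext; simp⟩
  rw [ModularForm.eq_zero_of_neg_one_mem h2 (by
    exact_mod_cast Nat.not_even_iff_odd.mp fun h ↦ hk h.two_dvd) f]
  rfl

theorem exists_hasDivision_etaTwo : ∃ x y : modularForms Γ(2) 2,
    (x : ℍ → ℂ) = etaLower 2 ^ 4 ∧ (y : ℍ → ℂ) = etaUpper 2 ^ 4 ∧ HasDivision Γ(2) x y := by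
  refine exists_hasDivision_eta (by norm_num) two_pos isSlashOrbit_etaOrbitTwo etaOrbitTwo_one
    (c := -(1 / 16)) (by norm_num) ?_ (fun g hg ↦ ?_) etaOrbitTwo_tendsto etaOrbitTwo_eq_smul
    fun k hk g ↦ modularForms_Gamma_two_eq_zero hk
  · rw [← etaTranslate_zero]
    exact etaUpper_two_slash_S
  · have := det_eq_one' g
    rw [hg, mul_zero, sub_zero] at this
    revert this
    generalize g 0 0 = a
    generalize g 1 1 = d
    revert a d
    decide

theorem exists_hasDivision_etaThree : ∃ x y : modularForms Γ(3) 1,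
    (x : ℍ → ℂ) = etaLower 3 ∧ (y : ℍ → ℂ) = etaUpper 3 ∧ HasDivision Γ(3) x y := by
  have := exists_hasDivision_eta (e := 1) (by norm_num) one_pos isSlashOrbit_etaOrbitThree
    (by rw [etaOrbitThree_one, pow_one]) kappaThree_ne_zero ?_ (fun g hg ↦ ?_) etaOrbitThree_tendsto
    etaOrbitThree_eq_smul fun k hk ↦ absurd (one_dvd k) hk
  · simpa only [pow_one] using this
  · rw [← etaTranslate_zero, pow_one, pow_one]
    exact etaUpper_three_slash_S
  · have := det_eq_one' g
    rw [hg, mul_zero, sub_zero] at this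
    revert this
    generalize g 0 0 = a
    generalize g 1 1 = d
    revert a d
    decide

end EtaForms

/-! ### Modularity from period one and E ∣ S = κ E(τ/N) -/

section Fricke

/-- The function `τ ↦ E((τ + x) / N)`, for `N = h⁻¹`. -/
noncomputable def translateRescale (h : ℝ) (hh : 0 < h) (x : ℝ) (E : ℍ → ℂ) : ℍ → ℂ :=
  fun τ ↦ E ((⟨h, hh⟩ : {x : ℝ // 0 < x}) • (x +ᵥ τ))

theorem coe_pos_smul {h : ℝ} (hh : 0 < h) (τ : ℍ) :
    (((⟨h, hh⟩ : {x : ℝ // 0 < x}) • τ : ℍ) : ℂ) = h * τ := by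
  rw [UpperHalfPlane.coe_pos_real_smul]
  rfl

theorem translateRescale_zero {h : ℝ} (hh : 0 < h) (E : ℍ → ℂ) :
    translateRescale h hh 0 E = rescale h hh E := by
  ext τ
  rw [translateRescale, zero_vadd, rescale]

theorem slash_T_eq_iff {k : ℤ} {E : ℍ → ℂ} :
    E ∣[k] T = E ↔ ∀ τ, E ((1 : ℝ) +ᵥ τ) = E τ := by
  rw [funext_iff]
  simp only [slash_T_apply]

theorem translateRescale_slash_T {h : ℝ} (hh : 0 < h) (x : ℝ) (E : ℍ → ℂ) (k : ℤ) :
    translateRescale h hh x E ∣[k] T = translateRescale h hh (x + 1) E := by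
  ext τ
  rw [slash_T_apply, translateRescale, vadd_vadd, translateRescale]

theorem translateRescale_add_natCast {h : ℝ} (hh : 0 < h) {N : ℕ} (hN : h * N = 1) (x : ℝ)
    {E : ℍ → ℂ} {k : ℤ} (hT : E ∣[k] T = E) :
    translateRescale h hh (x + N) E = translateRescale h hh x E := by
  ext τ
  rw [translateRescale, translateRescale, ← slash_T_eq_iff.mp hT (_ • (x +ᵥ τ))]
  congr 1
  ext
  have hN' : (h : ℂ) * N = 1 := by exact_mod_cast hN
  simp only [coe_pos_smul, coe_vadd]
  push_cast
  linear_combination hN'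

theorem tendsto_translateRescale {h : ℝ} (hh : 0 < h) (x : ℝ) {E : ℍ → ℂ} {c : ℂ}
    (hE : Tendsto E atImInfty (𝓝 c)) : Tendsto (translateRescale h hh x E) atImInfty (𝓝 c) := by
  refine hE.comp ?_
  rw [atImInfty, tendsto_comap_iff]
  have : Tendsto (fun τ : ℍ ↦ h * τ.im) atImInfty atTop := tendsto_comap.const_mul_atTop hh
  refine this.congr fun τ ↦ ?_
  simp [← coe_im, coe_vadd]

variable {N w : ℕ} {h : ℝ} {hh : 0 < h} {E : ℍ → ℂ} {κ : ℂ}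

/-- `E` is invariant under `S T ^ (-N) S⁻¹`. -/
theorem apply_div_eq_of_fricke (hN : h * N = 1) (hT : E ∣[(w : ℤ)] T = E)
    (hS : E ∣[(w : ℤ)] S = κ • rescale h hh E) {z z' : ℍ} (hz : (z' : ℂ) = z / (N * z + 1)) :
    E z' = (N * z + 1) ^ w * E z := by
  have key (τ : ℍ) : E (S • τ) = κ * τ ^ w * rescale h hh E τ := by
    have := congrFun hS τ
    rw [slash_S_apply, zpow_neg, mul_inv_eq_iff_eq_mul₀ (zpow_ne_zero _ τ.ne_zero)] at this
    rw [this, zpow_natCast, Pi.smul_apply, smul_eq_mul]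
    ring
  have hz0 : (N : ℂ) * z + 1 ≠ 0 := by
    intro h0
    rw [h0, div_zero] at hz
    exact z'.ne_zero hz
  have e1 : S • S • z = z := by
    ext
    rw [coe_S_smul, coe_S_smul]
    field_simp [z.ne_zero]
  have e2 : S • ((-(N : ℝ)) +ᵥ S • z) = z' := by
    ext
    rw [coe_S_smul, coe_vadd, coe_S_smul, hz]
    have := z.ne_zero
    push_cast
    have h2 : -(N : ℂ) + -1 / z = -(N * z + 1) / z := by field_simp; ring
    rw [h2]
    field_simp
  have e3 : rescale h hh E ((-(N : ℝ)) +ᵥ S • z) = rescale h hh E (S • z) := by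
    have := congrFun (translateRescale_add_natCast hh hN (-(N : ℝ)) hT) (S • z)
    rw [neg_add_cancel, translateRescale_zero] at this
    exact this.symm
  have h1 := key ((-(N : ℝ)) +ᵥ S • z)
  have h2 := key (S • z)
  rw [e1] at h2
  rw [e2, e3, coe_vadd, coe_S_smul] at h1
  rw [coe_S_smul] at h2
  rw [h1, h2]
  have := z.ne_zero
  push_cast
  have h3 : -(N : ℂ) + -1 / z = (N * z + 1) * (-1 / z) := by field_simp; ring
  rw [h3, mul_pow]
  ring

/-- With z = (τ - 1)/N one has (-1/τ + 1)/N = z/(Nz + 1) and Nz + 1 = τ, so `apply_div_eq_of_fricke`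
gives the translate by -1, which is also the one by N - 1. -/
theorem translateRescale_one_slash_S [NeZero N] (hN : h * N = 1) (hT : E ∣[(w : ℤ)] T = E)
    (hS : E ∣[(w : ℤ)] S = κ • rescale h hh E) :
    translateRescale h hh 1 E ∣[(w : ℤ)] S = translateRescale h hh (N - 1 : ℝ) E := by
  rw [← neg_add_eq_sub, translateRescale_add_natCast hh hN _ hT]
  ext τ
  have hN' : (h : ℂ) * N = 1 := by exact_mod_cast hN
  have hh' : (h : ℂ) ≠ 0 := by exact_mod_cast hh.ne'
  have hN0 : (N : ℂ) ≠ 0 := NeZero.ne _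
  have hτ := τ.ne_zero
  have h1 : (N : ℂ) * (h * (-1 + τ)) + 1 = τ := by linear_combination (τ - 1) * hN'
  rw [slash_S_apply, translateRescale, translateRescale, zpow_neg,
    mul_inv_eq_iff_eq_mul₀ (zpow_ne_zero _ τ.ne_zero), apply_div_eq_of_fricke hN hT hS
      (z := (⟨h, hh⟩ : {x : ℝ // 0 < x}) • ((-1 : ℝ) +ᵥ τ)), mul_comm]
  · simp only [coe_pos_smul, coe_vadd, Complex.ofReal_neg, Complex.ofReal_one, h1, zpow_natCast]
  · simp only [coe_pos_smul, coe_vadd, Complex.ofReal_neg, Complex.ofReal_one, h1, coe_S_smul]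
    field_simp
    ring

/-- The sign attached to a residue class modulo `2` or `3`. -/
noncomputable def signPow (w : ℕ) (x : ZMod N) : ℂ := (if x = 1 then 1 else -1) ^ w

/-- The orbit of `E` under `SL(2, ℤ)`, for `N = 2` or `N = 3`. -/
noncomputable def frickeOrbit (w : ℕ) (h : ℝ) (hh : 0 < h) (κ : ℂ) (E : ℍ → ℂ) (c d : ZMod N) :
    ℍ → ℂ :=
  if c = 0 then signPow w d • E
  -- For c = ±1 the row is c · (1, cd): it is reached from (1, cd) by the sign c^w, and (1, j)
  -- belongs to E ∣ S T^j.
  else (κ * signPow w c) • translateRescale h hh ((c * d).val : ℝ) E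

theorem signPow_one : signPow w (1 : ZMod N) = 1 := by simp [signPow]

/-- If -1 = 1 in ℤ/N, the sign is consistent only in even weight, hence the hypothesis `hw`. -/
theorem signPow_neg (hw : (-1 : ZMod N) = 1 → Even w) {x : ZMod N} (hx : x = 1 ∨ x = -1) :
    signPow w (-x) = (-1) ^ w * signPow w x := by
  by_cases h1 : (-1 : ZMod N) = 1
  · rw [(hw h1).neg_one_pow, one_mul]
    rcases hx with rfl | rfl <;> simp [h1]
  · rcases hx with rfl | rfl <;> simp [signPow, h1, ← mul_pow]

theorem frickeOrbit_slash_T [NeZero N] (hN : h * N = 1) (hN1 : 1 < N)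
    (hunit : ∀ x : ZMod N, x = 0 ∨ x = 1 ∨ x = -1)
    (hT : E ∣[(w : ℤ)] T = E) (c d : ZMod N) :
    frickeOrbit w h hh κ E c d ∣[(w : ℤ)] T = frickeOrbit w h hh κ E c (c + d) := by
  by_cases hc : c = 0
  · rw [frickeOrbit, frickeOrbit, if_pos hc, if_pos hc, ModularForm.SL_smul_slash, hT, hc, zero_add]
  · rw [frickeOrbit, frickeOrbit, if_neg hc, if_neg hc, ModularForm.SL_smul_slash,
      translateRescale_slash_T]
    congr 1
    have hcc : c * c = 1 := by
      rcases hunit c with rfl | rfl | rfl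
      · exact absurd rfl hc
      · exact mul_one 1
      · ring
    rw [mul_add, hcc]
    have : Fact (1 < N) := ⟨hN1⟩
    have h1 : (1 + c * d).val = (c * d).val + 1 ∨ ((c * d).val + 1 = N ∧ (1 + c * d).val = 0) := by
      rw [add_comm, ZMod.val_add, ZMod.val_one]
      rcases (Nat.succ_le_of_lt (ZMod.val_lt (c * d))).lt_or_eq with h' | h'
      · exact Or.inl (Nat.mod_eq_of_lt h')
      · right
        rw [Nat.succ_eq_add_one] at h'
        rw [h', Nat.mod_self]
        exact ⟨rfl, rfl⟩
    rcases h1 with h1 | ⟨h1, h2⟩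
    · rw [h1, Nat.cast_succ]
    · rw [h2, ← Nat.cast_succ, Nat.succ_eq_add_one, h1, Nat.cast_zero]
      conv_lhs => rw [← zero_add (N : ℝ), translateRescale_add_natCast hh hN _ hT]

theorem frickeOrbit_slash_S [NeZero N] (hN : h * N = 1) (hN1 : 1 < N)
    (hunit : ∀ x : ZMod N, x = 0 ∨ x = 1 ∨ x = -1)
    (hw : (-1 : ZMod N) = 1 → Even w) (hT : E ∣[(w : ℤ)] T = E) (hκ : κ ≠ 0)
    (hS : E ∣[(w : ℤ)] S = κ • rescale h hh E) (c d : ZMod N) (hcd : c ≠ 0 ∨ d ≠ 0) :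
    frickeOrbit w h hh κ E c d ∣[(w : ℤ)] S = frickeOrbit w h hh κ E d (-c) := by
  have : Fact (1 < N) := ⟨hN1⟩
  have h0 : translateRescale h hh 0 E ∣[(w : ℤ)] S = (κ⁻¹ * (-1) ^ w) • E := by
    have := slash_S_slash_S E w
    rw [hS, ModularForm.SL_smul_slash] at this
    rw [translateRescale_zero, ← inv_smul_smul₀ hκ (rescale h hh E ∣[(w : ℤ)] S), this, smul_smul,
      zpow_natCast]
  have h1 := translateRescale_one_slash_S hN hT hS
  have h2 : translateRescale h hh (N - 1 : ℝ) E ∣[(w : ℤ)] S =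
      ((-1 : ℂ) ^ w) • translateRescale h hh 1 E := by
    rw [← h1, slash_S_slash_S, zpow_natCast]
  have hv1 : (((1 : ZMod N).val : ℕ) : ℝ) = 1 := by rw [ZMod.val_one]; simp
  have hv2 : (((-1 : ZMod N).val : ℕ) : ℝ) = N - 1 := by
    rw [ZMod.val_neg_of_ne_zero, ZMod.val_one, Nat.cast_sub hN1.le, Nat.cast_one]
  have one_ne : (1 : ZMod N) ≠ 0 := one_ne_zero
  have neg_ne : (-1 : ZMod N) ≠ 0 := neg_ne_zero.mpr one_ne_zero
  have unit {x : ZMod N} (hx : x ≠ 0) : x = 1 ∨ x = -1 := (hunit x).resolve_left hx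
  have sgn := signPow_neg hw (Or.inl rfl : (1 : ZMod N) = 1 ∨ (1 : ZMod N) = -1)
  rw [signPow_one, mul_one] at sgn
  by_cases hc : c = 0
  · have hd : d ≠ 0 := hcd.resolve_left (not_not.mpr hc)
    rw [frickeOrbit, frickeOrbit, if_pos hc, if_neg hd, hc, ModularForm.SL_smul_slash, hS,
      neg_zero, mul_zero, ZMod.val_zero, Nat.cast_zero, translateRescale_zero, smul_smul, mul_comm]
  by_cases hd : d = 0
  · rw [frickeOrbit, frickeOrbit, if_pos hd, if_neg hc, hd, ModularForm.SL_smul_slash,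
      mul_zero, ZMod.val_zero, Nat.cast_zero, h0, smul_smul, signPow_neg hw (unit hc)]
    congr 1
    field_simp
  rw [frickeOrbit, frickeOrbit, if_neg hc, if_neg hd, ModularForm.SL_smul_slash]
  have hm : (-1 : ℂ) ^ w * (-1) ^ w = 1 := by rw [← mul_pow]; norm_num
  rcases unit hc with rfl | rfl <;> rcases unit hd with rfl | rfl
  · simp only [mul_one, mul_neg, signPow_one, hv1, hv2, h1]
  · simp only [mul_one, mul_neg, neg_neg, signPow_one, sgn, hv1, hv2, h2, smul_smul]
  · simp only [mul_one, neg_neg, signPow_one, sgn, hv1, hv2, h2, smul_smul, mul_assoc, hm]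
  · simp only [mul_one, mul_neg, neg_neg, sgn, hv1, hv2, h1]

/-- Equality would make E invariant under τ ↦ Nτ. Iterating towards i∞ forces E = 1, and then the
S-relation says that κ τ^w = 1 for all τ, which fails at i and 2i. -/
theorem ne_rescale_of_fricke (hN : h * N = 1) (hN1 : 1 < N) (hw : 0 < w)
    (hS : E ∣[(w : ℤ)] S = κ • rescale h hh E) (hE : Tendsto E atImInfty (𝓝 1)) :
    rescale h hh E ≠ E := by
  intro heq
  have h1 : h < 1 := by
    have : (1 : ℝ) < N := mod_cast hN1
    nlinarith
  have hconst (τ : ℍ) : E τ = 1 := by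
    let f : ℍ → ℍ := fun z ↦ (⟨h⁻¹, inv_pos.mpr hh⟩ : {x : ℝ // 0 < x}) • z
    have hf (z : ℍ) : E (f z) = E z := by
      rw [← congrFun heq (f z), rescale]
      congr 1
      ext
      have : (h : ℂ) ≠ 0 := by exact_mod_cast hh.ne'
      simp only [f, coe_pos_smul]
      push_cast
      field_simp
    have hk (k : ℕ) : E (f^[k] τ) = E τ := by
      induction k with
      | zero => rfl
      | succ k ih => rw [Function.iterate_succ_apply', hf, ih]
    have him (k : ℕ) : (f^[k] τ).im = h⁻¹ ^ k * τ.im := by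
      induction k with
      | zero => simp
      | succ k ih =>
        rw [Function.iterate_succ_apply', pow_succ', mul_assoc, ← ih, ← coe_im, coe_pos_smul,
          Complex.im_ofReal_mul, coe_im]
    have hlim : Tendsto (fun k ↦ f^[k] τ) atTop atImInfty := by
      rw [atImInfty, tendsto_comap_iff]
      refine ((tendsto_pow_atTop_atTop_of_one_lt (one_lt_inv₀ hh |>.mpr h1)).atTop_mul_const
        τ.im_pos).congr fun k ↦ (him k).symm
    exact tendsto_nhds_unique (tendsto_const_nhds.congr fun k ↦ (hk k).symm) (hE.comp hlim)
  have key (τ : ℍ) : (τ : ℂ) ^ w * κ = 1 := by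
    have := congrFun hS τ
    rw [slash_S_apply, hconst, Pi.smul_apply, rescale, hconst, one_mul, smul_eq_mul, mul_one,
      zpow_neg, zpow_natCast, inv_eq_iff_eq_inv] at this
    rw [this, inv_mul_cancel₀]
    rintro rfl
    rw [inv_zero] at this
    exact τ.ne_zero (pow_eq_zero_iff hw.ne' |>.mp this)
  have k1 := key UpperHalfPlane.I
  have k2 := key ((⟨2, two_pos⟩ : {x : ℝ // 0 < x}) • UpperHalfPlane.I)
  rw [coe_pos_smul, mul_pow, mul_assoc, k1, mul_one] at k2
  have : (2 : ℝ) ^ w = 1 := by exact_mod_cast k2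
  exact (one_lt_pow₀ (one_lt_two : (1 : ℝ) < 2) hw.ne').ne' this

theorem exists_forms_of_fricke [NeZero N] (hN : h * N = 1) (hN1 : 1 < N)
    (hw0 : 0 < w)
    (hunit : ∀ x : ZMod N, x = 0 ∨ x = 1 ∨ x = -1)
    (hw : (-1 : ZMod N) = 1 → Even w) (hd : MDiff E) (hE : Tendsto E atImInfty (𝓝 1))
    (hT : E ∣[(w : ℤ)] T = E) (hκ : κ ≠ 0) (hS : E ∣[(w : ℤ)] S = κ • rescale h hh E) :
    ∃ a b : modularForms Γ(N) w, (a : ℍ → ℂ) = rescale h hh E ∧ (b : ℍ → ℂ) = E ∧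
      Tendsto (a : ℍ → ℂ) atImInfty (𝓝 1) ∧ Tendsto (b : ℍ → ℂ) atImInfty (𝓝 1) ∧ a ≠ b := by
  have : Fact (1 < N) := ⟨hN1⟩
  let F (g : SL(2, ZMod N)) : ℍ → ℂ := frickeOrbit w h hh κ E (g 1 0) (g 1 1)
  have hF1 : F 1 = E := by simp [F, frickeOrbit, signPow_one]
  have hF : IsSlashOrbit (w : ℤ) F :=
    { slash_S := fun g ↦ by
        obtain ⟨-, -, h3, h4⟩ := map_mul_S_apply g
        simp only [F]
        rw [h3, h4, frickeOrbit_slash_S hN hN1 hunit hw hT hκ hS _ _ (row_ne_zero g)]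
      slash_T := fun g ↦ by
        obtain ⟨-, -, h3, h4⟩ := map_mul_T_apply g
        simp only [F]
        rw [h3, h4, frickeOrbit_slash_T hN hN1 hunit hT] }
  have hb : E ∈ modularForms Γ(N) w := by
    have := hF.mem_modularForms (hF1 ▸ hd) fun g ↦ ?_
    · rwa [hF1] at this
    · simp only [F, frickeOrbit]
      split_ifs
      · exact (tendsto_smul hE _).isBigO_one ℝ
      · exact (tendsto_smul (tendsto_translateRescale hh _ hE) _).isBigO_one ℝ
  have ha : rescale h hh E ∈ modularForms Γ(N) w := by
    have := (modularForms Γ(N) w).smul_mem κ⁻¹ (slash_mem_modularForms_Gamma hb S)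
    rwa [hS, inv_smul_smul₀ hκ] at this
  refine ⟨⟨_, ha⟩, ⟨_, hb⟩, rfl, rfl, ?_, hE, fun heq ↦ ?_⟩
  · simpa only [translateRescale_zero] using tendsto_translateRescale hh 0 hE
  · exact ne_rescale_of_fricke hN hN1 hw0 hS hE (congrArg Subtype.val heq)

end Fricke

/-! ### Power series in q with polynomially bounded coefficients -/

section QSeries

theorem differentiableOn_tsum_mul_pow {c : ℕ → ℂ}
    (hc : ∀ q : ℂ, ‖q‖ < 1 → Summable fun n ↦ ‖c n * q ^ n‖) :
    DifferentiableOn ℂ (fun q : ℂ ↦ ∑' n, c n * q ^ n) (Metric.ball 0 1) := by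
  have hr : 1 ≤ (FormalMultilinearSeries.ofScalars ℂ c).radius := by
    refine le_of_forall_lt_imp_le_of_dense fun r hr ↦ ?_
    lift r to NNReal using hr.ne_top
    refine FormalMultilinearSeries.le_radius_of_summable _ ?_
    have := hc r (by simpa using hr)
    simpa using this
  have h1 := ((FormalMultilinearSeries.ofScalars ℂ c).hasFPowerSeriesOnBall
    (one_pos.trans_le hr)).mono one_pos hr
  have h2 := h1.differentiableOn
  rw [← ENNReal.coe_one, Metric.eball_coe, NNReal.coe_one] at h2
  refine h2.congr fun q _ ↦ ?_
  simp [FormalMultilinearSeries.sum, mul_comm]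

theorem summable_norm_mul_pow_of_le {b : ℕ → ℂ} {k : ℕ} (hb : ∀ n, ‖b n‖ ≤ n ^ k) {q : ℂ}
    (hq : ‖q‖ < 1) : Summable fun n ↦ ‖b n * q ^ n‖ := by
  refine (summable_norm_pow_mul_geometric_of_norm_lt_one k hq).of_nonneg_of_le
    (fun n ↦ norm_nonneg _) fun n ↦ ?_
  rw [norm_mul, norm_mul, norm_pow (n : ℂ), Complex.norm_natCast]
  exact mul_le_mul_of_nonneg_right (hb n) (norm_nonneg _)

/-- The `q`-series `∑_{n ≥ 1} b n q ^ n`. -/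
noncomputable def qSeries (b : ℕ → ℂ) (τ : ℍ) : ℂ :=
  ∑' n : ℕ+, b n * Complex.exp (2 * π * Complex.I * τ) ^ (n : ℕ)

variable {b : ℕ → ℂ} {k : ℕ}

theorem qSeries_eq (hb : ∀ n, ‖b n‖ ≤ n ^ k) (h0 : b 0 = 0) (τ : ℍ) :
    qSeries b τ = ∑' n : ℕ, b n * Complex.exp (2 * π * Complex.I * τ) ^ n := by
  rw [qSeries, ← tsum_zero_pnat_eq_tsum_nat
    (summable_norm_mul_pow_of_le hb (norm_exp_two_pi_I_lt_one τ)).of_norm, h0, zero_mul, zero_add]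

theorem mdifferentiable_qSeries (hb : ∀ n, ‖b n‖ ≤ n ^ k) (h0 : b 0 = 0) : MDiff (qSeries b) := by
  rw [UpperHalfPlane.mdifferentiable_iff]
  have h1 := differentiableOn_tsum_mul_pow fun q hq ↦ summable_norm_mul_pow_of_le hb hq
  have h2 : DifferentiableOn ℂ (fun z : ℂ ↦ Complex.exp (2 * π * Complex.I * z))
      {z | 0 < z.im} := by fun_prop
  refine (h1.comp h2 fun z hz ↦ ?_).congr fun z hz ↦ ?_
  · simpa using norm_exp_two_pi_I_lt_one ⟨z, hz⟩
  · rw [Function.comp_apply, qSeries_eq hb h0, ofComplex_apply_of_im_pos hz, Function.comp_apply]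

theorem tendsto_qSeries (hb : ∀ n, ‖b n‖ ≤ n ^ k) (h0 : b 0 = 0) :
    Tendsto (qSeries b) atImInfty (𝓝 0) := by
  have h1 := ((differentiableOn_tsum_mul_pow fun q hq ↦
    summable_norm_mul_pow_of_le hb hq).differentiableAt
    (Metric.isOpen_ball.mem_nhds (Metric.mem_ball_self one_pos))).continuousAt.tendsto
  have h3 : ∑' n : ℕ, b n * 0 ^ n = 0 := by
    rw [tsum_eq_single 0 fun n hn ↦ by rw [zero_pow hn, mul_zero], h0, zero_mul]
  rw [h3] at h1
  refine (h1.comp (qParam_tendsto_atImInfty one_pos)).congr fun τ ↦ ?_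
  rw [qSeries_eq hb h0, Function.comp_apply, Function.Periodic.qParam, Complex.ofReal_one, div_one]

theorem qSeries_vadd (b : ℕ → ℂ) (τ : ℍ) : qSeries b ((1 : ℝ) +ᵥ τ) = qSeries b τ := by
  have : Complex.exp (2 * π * Complex.I * ((1 : ℝ) +ᵥ τ : ℍ)) =
      Complex.exp (2 * π * Complex.I * τ) := by
    rw [coe_vadd, mul_add, Complex.exp_add]
    simp
  rw [qSeries, qSeries, this]

end QSeries

/-! ### The Eisenstein series of level two -/

section LevelTwo

open EisensteinSeries (E2)
open scoped ArithmeticFunction.sigma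

theorem E2_eq_qSeries (τ : ℍ) : E2 τ = 1 - 24 * qSeries (fun n ↦ (σ 1 n : ℂ)) τ := by
  rw [EisensteinSeries.E2_eq_tsum_cexp]
  rfl

theorem tendsto_E2 : Tendsto E2 atImInfty (𝓝 1) := by
  have := ((tendsto_qSeries (b := fun n ↦ (σ 1 n : ℂ)) (k := 2) (fun n ↦ ?_)
    (by simp)).const_mul 24).const_sub 1
  · rw [mul_zero, sub_zero] at this
    exact this.congr fun τ ↦ (E2_eq_qSeries τ).symm
  · rw [Complex.norm_natCast]
    exact_mod_cast ArithmeticFunction.sigma_le_pow_succ 1 n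

theorem E2_vadd (τ : ℍ) : E2 ((1 : ℝ) +ᵥ τ) = E2 τ := by
  rw [E2_eq_qSeries, E2_eq_qSeries, qSeries_vadd]

/-- The value of the constant is irrelevant: the anomaly c τ cancels in 2 E₂(2τ) - E₂(τ). -/
theorem exists_E2_S_smul : ∃ c : ℂ, ∀ τ : ℍ, E2 (S • τ) = τ ^ 2 * E2 τ + c * τ := by
  refine ⟨-(1 / (2 * riemannZeta 2)) * (2 * π * Complex.I), fun τ ↦ ?_⟩
  have h := congrFun (EisensteinSeries.E2_slash_action S) τ
  rw [slash_S_apply, zpow_neg, mul_inv_eq_iff_eq_mul₀ (zpow_ne_zero _ τ.ne_zero)] at h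
  rw [h, Pi.sub_apply, Pi.smul_apply, EisensteinSeries.D2_S, smul_eq_mul]
  have := τ.ne_zero
  rw [zpow_ofNat]
  field_simp
  ring

theorem mdifferentiable_rescale {h : ℝ} (hh : 0 < h) {f : ℍ → ℂ} (hf : MDiff f) :
    MDiff (rescale h hh f) := by
  rw [UpperHalfPlane.mdifferentiable_iff] at hf ⊢
  have him {z : ℂ} (hz : 0 < z.im) : 0 < (h * z : ℂ).im := by
    rw [Complex.im_ofReal_mul]
    exact mul_pos hh hz
  have h2 : DifferentiableOn ℂ (fun z : ℂ ↦ (h : ℂ) * z) {z | 0 < z.im} := by fun_prop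
  refine (hf.comp h2 fun z hz ↦ him hz).congr fun z hz ↦ ?_
  rw [Function.comp_apply, Function.comp_apply, Function.comp_apply, rescale]
  congr 1
  ext
  rw [coe_pos_smul, ofComplex_apply_of_im_pos hz, ofComplex_apply_of_im_pos (him hz)]

theorem exists_eisensteinTwoTwo : ∃ a b : modularForms Γ(2) 2,
    (a : ℍ → ℂ) = rescale (1 / 2) one_half_pos eisensteinTwoTwo ∧ (b : ℍ → ℂ) = eisensteinTwoTwo ∧
      Tendsto (a : ℍ → ℂ) atImInfty (𝓝 1) ∧ Tendsto (b : ℍ → ℂ) atImInfty (𝓝 1) ∧ a ≠ b := by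
  refine exists_forms_of_fricke (κ := -(1 / 2)) (by norm_num) one_lt_two two_pos (by decide)
    (fun _ ↦ even_two) ?_ ?_ ?_ (by norm_num) ?_
  · exact (mdifferentiable_const.mul (mdifferentiable_rescale two_pos
      E2_mdifferentiable)).sub E2_mdifferentiable
  · have h1 := tendsto_translateRescale two_pos 0 tendsto_E2
    rw [translateRescale_zero] at h1
    have := (h1.const_mul 2).sub tendsto_E2
    norm_num at this
    exact this
  · rw [slash_T_eq_iff]
    intro τ
    have : (⟨2, two_pos⟩ : {x : ℝ // 0 < x}) • ((1 : ℝ) +ᵥ τ) =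
        (1 : ℝ) +ᵥ ((1 : ℝ) +ᵥ (⟨2, two_pos⟩ : {x : ℝ // 0 < x}) • τ) := by
      ext
      simp only [coe_pos_smul, coe_vadd]
      push_cast
      ring
    rw [eisensteinTwoTwo, eisensteinTwoTwo, rescale, this, E2_vadd, E2_vadd, E2_vadd, rescale]
  · obtain ⟨c, hc⟩ := exists_E2_S_smul
    ext τ
    -- 2 · Sτ = S(τ/2), so the first summand becomes (τ²/2) E₂(τ/2) + c τ, which gives κ = -1/2.
    have e1 : (⟨2, two_pos⟩ : {x : ℝ // 0 < x}) • S • τ =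
        S • (⟨1 / 2, one_half_pos⟩ : {x : ℝ // 0 < x}) • τ := by
      ext
      have := τ.ne_zero
      simp only [coe_pos_smul, coe_S_smul]
      push_cast
      field_simp
    have e2 : (⟨2, two_pos⟩ : {x : ℝ // 0 < x}) • (⟨1 / 2, one_half_pos⟩ : {x : ℝ // 0 < x}) • τ =
        τ := by
      ext
      simp only [coe_pos_smul]
      push_cast
      ring
    rw [slash_S_apply, zpow_neg, mul_inv_eq_iff_eq_mul₀ (zpow_ne_zero _ τ.ne_zero),
      eisensteinTwoTwo, rescale, e1, hc, hc, Pi.smul_apply, rescale, eisensteinTwoTwo, rescale, e2,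
      coe_pos_smul, smul_eq_mul, Nat.cast_ofNat, zpow_ofNat]
    push_cast
    ring

end LevelTwo

/-! ### The Weierstrass zeta function and its cotangent expansion -/

section Zeta

open Complex (cot integerComplement)

/-- The regularised summands of the Weierstrass zeta function. -/
noncomputable def zetaTerm (z w : ℂ) : ℂ := z / (z ^ 2 - w ^ 2) + z / w ^ 2

/-- The odd part of the sum of `zetaTerm` over the lattice `ℤ τ + ℤ`. -/
noncomputable def latticeZeta (z : ℂ) (τ : ℍ) : ℂ :=
  ∑' x : Fin 2 → ℤ, zetaTerm z (x 0 * τ + x 1)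

/-- The term equals z³ / (w² (z² - w²)), hence is O(|w|^(-4)). Absolute convergence permits
rearranging the lattice sum. -/
theorem summable_zetaTerm (z : ℂ) (τ : ℍ) :
    Summable fun x : Fin 2 → ℤ ↦ zetaTerm z (x 0 * τ + x 1) := by
  refine EisensteinSeries.summable_of_isBigO_rpow_norm (a := 4) (by norm_num) ?_
  have h0 : (fun x : Fin 2 → ℤ ↦ ((x 0 : ℂ) * τ + x 1)⁻¹) =O[cofinite] fun x ↦ ‖x‖⁻¹ := by
    simpa using EisensteinSeries.isBigO_linear_add_const_vec τ 0 0
  have hnorm : Tendsto (fun x : Fin 2 → ℤ ↦ ‖x‖⁻¹) cofinite (𝓝 0) := by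
    rw [← Filter.cocompact_eq_cofinite]
    exact tendsto_inv_atTop_zero.comp (tendsto_norm_cocompact_atTop (E := Fin 2 → ℤ))
  have h1 := h0.trans_tendsto hnorm
  have h2 : Tendsto (fun x : Fin 2 → ℤ ↦ z ^ 2 * ((x 0 : ℂ) * τ + x 1)⁻¹ ^ 2 - 1) cofinite
      (𝓝 (-1)) := by
    simpa using ((h1.pow 2).const_mul (z ^ 2)).sub_const 1
  have h3 : ∀ᶠ x : Fin 2 → ℤ in cofinite, z ^ 2 * ((x 0 : ℂ) * τ + x 1)⁻¹ ^ 2 - 1 ≠ 0 :=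
    h2.eventually_ne (by norm_num)
  have h4 := ((h2.inv₀ (by norm_num)).isBigO_one ℝ).const_mul_left (z ^ 3)
  have h5 := h4.mul (h0.pow 4)
  refine (h5.congr' ?_ ?_)
  · filter_upwards [h3, (Set.finite_singleton (0 : Fin 2 → ℤ)).compl_mem_cofinite] with x hx hx0
    have hw : (x 0 : ℂ) * τ + x 1 ≠ 0 := by
      have := UpperHalfPlane.linear_ne_zero (cd := fun i ↦ (x i : ℝ)) τ (by
        intro h
        refine hx0 (funext fun i ↦ ?_)
        simpa using congrFun h i)
      exact_mod_cast this
    generalize (x 0 : ℂ) * τ + x 1 = w at hx hw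
    have hzw : z ^ 2 - w ^ 2 ≠ 0 := by
      intro h
      apply hx
      field_simp
      simpa using h
    have hzw' : z ^ 2 * w⁻¹ ^ 2 - 1 = (z ^ 2 - w ^ 2) / w ^ 2 := by field_simp
    rw [hzw', zetaTerm]
    field_simp
    ring
  · refine Eventually.of_forall fun x ↦ ?_
    simp only [one_mul, inv_pow]
    norm_cast

/-- The lattice of Sτ is τ⁻¹ times that of τ, and the terms are homogeneous of degree -1 in (z, w).
-/
theorem latticeZeta_S_smul (z : ℂ) (τ : ℍ) :
    latticeZeta (z / τ) (S • τ) = τ * latticeZeta z τ := by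
  let e : (Fin 2 → ℤ) ≃ (Fin 2 → ℤ) :=
    { toFun := fun x ↦ ![x 1, -x 0]
      invFun := fun x ↦ ![-x 1, x 0]
      left_inv := fun x ↦ by ext i; fin_cases i <;> simp
      right_inv := fun x ↦ by ext i; fin_cases i <;> simp }
  rw [latticeZeta, latticeZeta, ← tsum_mul_left,
    ← e.tsum_eq fun x : Fin 2 → ℤ ↦ (τ : ℂ) * zetaTerm z (x 0 * τ + x 1)]
  refine tsum_congr fun x ↦ ?_
  have hτ := τ.ne_zero
  have h : (x 0 : ℂ) * (S • τ : ℍ) + x 1 = ((e x 0 : ℤ) * τ + (e x 1 : ℤ)) / τ := by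
    have h0 : e x 0 = x 1 := rfl
    have h1 : e x 1 = -x 0 := rfl
    rw [h0, h1, coe_S_smul]
    push_cast
    field_simp
    ring
  rw [h]
  generalize ((e x 0 : ℤ) : ℂ) * τ + (e x 1 : ℤ) = w
  rw [zetaTerm, zetaTerm, div_pow, div_pow, ← sub_div, div_div_div_eq, div_div_div_eq]
  have h2 (c : ℂ) : z * (τ : ℂ) ^ 2 / (τ * c) = τ * (z / c) := by
    rcases eq_or_ne c 0 with rfl | hc
    · simp
    · field_simp
  rw [h2, h2, mul_add]

theorem tsum_add_inv_eq_cot {a b : ℂ} (ha : a ∈ integerComplement)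
    (hb : b ∈ integerComplement) (hs : Summable fun n : ℤ ↦ 1 / (b - n) + 1 / (a + n)) :
    ∑' n : ℤ, (1 / (b - n) + 1 / (a + n)) = π * cot (π * a) + π * cot (π * b) := by
  have hsum {x : ℂ} (hx : x ∈ integerComplement) :
      Summable fun n : ℕ+ ↦ 1 / (x - n) + 1 / (x + n) := by
    have := summable_cotTerm hx
    rw [summable_pnat_iff_summable_succ (f := fun n : ℕ ↦ 1 / (x - n) + 1 / (x + n))]
    simpa [cotTerm] using this
  rw [cot_series_rep ha, cot_series_rep hb, tsum_int_eq_zero_add_tsum_pnat hs,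
    show 1 / a + ∑' n : ℕ+, (1 / (a - n) + 1 / (a + n)) +
      (1 / b + ∑' n : ℕ+, (1 / (b - n) + 1 / (b + n))) = (1 / a + 1 / b) +
      (∑' n : ℕ+, (1 / (a - n) + 1 / (a + n)) + ∑' n : ℕ+, (1 / (b - n) + 1 / (b + n))) by ring,
    ← (hsum ha).tsum_add (hsum hb), add_assoc, ← Summable.tsum_add]
  · congr 1
    · simp [add_comm]
    · refine tsum_congr fun n ↦ ?_
      push_cast
      ring
  · exact hs.comp_injective (i := fun n : ℕ+ ↦ (n : ℤ)) fun m n h ↦ by simpa using h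
  · exact hs.comp_injective (i := fun n : ℕ+ ↦ -(n : ℤ)) fun m n h ↦ by simpa using h

variable {z : ℂ} {τ : ℍ}

/-- Subtracting z/w², whose iterated sum is z G₂, leaves half of 1/(z - w) + 1/(z + w), and each row
sums to cotangents. The symmetric summation is needed because G₂ converges only conditionally. At w
= 0 the convention z/0 = 0 gives the right term 1/z. -/
theorem hasSum_cot_latticeZeta (ha : ∀ m : ℤ, z + m * τ ∈ integerComplement) :
    HasSum (fun m : ℤ ↦ 1 / 2 * (π * cot (π * (z + m * τ)) + π * cot (π * (z - m * τ))))
      (latticeZeta z τ - z * EisensteinSeries.G2 τ) (SummationFilter.symmetricIcc ℤ) := by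
  have hs : Summable fun p : ℤ × ℤ ↦ zetaTerm z (p.1 * τ + p.2) :=
    (finTwoArrowEquiv ℤ).symm.summable_iff.mpr (summable_zetaTerm z τ)
  have hW : HasSum (fun p : ℤ × ℤ ↦ zetaTerm z (p.1 * τ + p.2)) (latticeZeta z τ) := by
    rw [latticeZeta, ← (finTwoArrowEquiv ℤ).symm.tsum_eq]
    exact hs.hasSum
  have h1 := hW.prod_fiberwise fun m ↦ (hs.prod_factor m).hasSum
  have h2 := h1.mono_left (SummationFilter.symmetricIcc ℤ).le_atTop
  have h3 : HasSum (fun m ↦ EisensteinSeries.e2Summand m τ) (EisensteinSeries.G2 τ)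
      (SummationFilter.symmetricIcc ℤ) :=
    (EisensteinSeries.summable_e2Summand_symmetricIcc τ).hasSum
  have h4 := HasSum.sub h2 (h3.mul_left z)
  refine h4.congr_fun ?_
  intro m
  have hE := (EisensteinSeries.e2Summand_summable m τ).mul_left z
  have hb : z - m * τ ∈ integerComplement := by
    have := ha (-m)
    push_cast at this
    rwa [neg_mul, ← sub_eq_add_neg] at this
  have key (n : ℤ) : zetaTerm z (m * τ + n) - z * EisensteinSeries.eisSummand 2 ![m, n] τ =
      1 / 2 * (1 / ((z - m * τ) - n) + 1 / ((z + m * τ) + n)) := by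
    have i1 := Complex.integerComplement_add_ne_zero (ha m) n
    have i2 := Complex.integerComplement_add_ne_zero hb (-n)
    push_cast at i2
    rw [← sub_eq_add_neg] at i2
    have i3 : z ^ 2 - (m * τ + n) ^ 2 = (z - m * τ - n) * (z + m * τ + n) := by ring
    rw [zetaTerm, i3, EisensteinSeries.eisSummand]
    simp only [Matrix.cons_val_zero, Matrix.cons_val_one, zpow_neg, zpow_ofNat]
    field_simp
    ring
  have h5 := (hs.prod_factor m).sub hE
  have h6 := ((hs.prod_factor m).hasSum.sub hE.hasSum).tsum_eq
  simp only [key] at h5 h6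
  rw [tsum_mul_left, tsum_add_inv_eq_cot (ha m) hb
    ((summable_mul_left_iff (by norm_num)).mp h5)] at h6
  rw [h6, EisensteinSeries.e2Summand, tsum_mul_left]

theorem tendsto_cot_latticeZeta (ha : ∀ m : ℤ, z + m * τ ∈ integerComplement) :
    Tendsto (fun N : ℕ ↦ π * cot (π * z) + ∑ m ∈ Finset.range N,
      (π * cot (π * (z + (m + 1 : ℕ) * τ)) + π * cot (π * (z - (m + 1 : ℕ) * τ)))) atTop
      (𝓝 (latticeZeta z τ - z * EisensteinSeries.G2 τ)) := by
  have h := hasSum_cot_latticeZeta ha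
  rw [HasSum, SummationFilter.symmetricIcc_eq_map_Icc_nat, tendsto_map'_iff] at h
  refine h.congr fun N ↦ ?_
  rw [Function.comp_apply, Finset.sum_Icc_of_even_eq_range (fun m ↦ by push_cast; ring_nf),
    Finset.sum_range_succ', smul_add, Finset.smul_sum]
  simp only [nsmul_eq_mul, Int.cast_natCast, Int.cast_zero, Nat.cast_zero, zero_mul, add_zero,
    sub_zero, Nat.cast_ofNat]
  rw [add_sub_assoc, add_comm]
  congr 1
  · ring
  · exact Finset.sum_congr rfl fun m _ ↦ by ring

end Zeta

/-! ### Lambert series summed by rows and by columns -/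

section Lambert

theorem hasSum_lambert {χ : ℕ → ℂ} (hχ : ∀ n, ‖χ n‖ ≤ 1) {q : ℂ} (hq : ‖q‖ < 1) :
    HasSum (fun c : ℕ+ × ℕ+ ↦ χ c.2 * q ^ (c.1 * c.2 : ℕ))
      (∑' n : ℕ+, (∑ d ∈ (n : ℕ).divisors, χ d) * q ^ (n : ℕ)) := by
  have hs : Summable fun c : ℕ+ × ℕ+ ↦ χ c.2 * q ^ (c.1 * c.2 : ℕ) := by
    refine Summable.of_norm_bounded (summable_prod_mul_pow 0 hq).norm fun c ↦ ?_
    rw [norm_mul, pow_zero, one_mul]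
    exact mul_le_of_le_one_left (norm_nonneg _) (hχ _)
  convert! hs.hasSum using 1
  have hs' := sigmaAntidiagonalEquivProd.summable_iff.mpr hs
  rw [← sigmaAntidiagonalEquivProd.tsum_eq]
  refine Eq.trans ?_ (Summable.tsum_sigma hs').symm
  refine tsum_congr fun n ↦ ?_
  rw [tsum_fintype]
  simp only [Function.comp_apply, sigmaAntidiagonalEquivProd, divisorsAntidiagonalFactors,
    Equiv.coe_fn_mk, PNat.mk_coe, Finset.univ_eq_attach]
  rw [(n : ℕ).divisorsAntidiagonal.sum_attach fun x : ℕ × ℕ ↦ χ x.2 * q ^ (x.1 * x.2),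
    Nat.sum_divisorsAntidiagonal' fun x y ↦ χ y * q ^ (x * y), Finset.sum_mul]
  refine Finset.sum_congr rfl fun d hd ↦ ?_
  rw [Nat.div_mul_cancel (Nat.dvd_of_mem_divisors hd)]

theorem summable_pnat_pow {r : ℂ} (hr : ‖r‖ < 1) : Summable fun k : ℕ+ ↦ r ^ (k : ℕ) :=
  (summable_geometric_of_norm_lt_one hr).comp_injective PNat.coe_injective

theorem tendsto_sum_range_of_hasSum_pnat {f : ℕ → ℂ} {a : ℂ} (h : HasSum (fun n : ℕ+ ↦ f n) a) :
    Tendsto (fun N ↦ ∑ n ∈ Finset.range N, f (n + 1)) atTop (𝓝 a) :=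
  (Equiv.pnatEquivNat.symm.hasSum_iff.mpr h).tendsto_sum_nat

variable {χ : ℕ → ℂ} {q : ℂ}

theorem norm_pow_lt_one {q : ℂ} (hq : ‖q‖ < 1) {m : ℕ} (hm : m ≠ 0) : ‖q ^ m‖ < 1 := by
  rw [norm_pow]
  exact pow_lt_one₀ (norm_nonneg _) hq hm

theorem hasSum_lambert_row (hχ : ∀ n, ‖χ n‖ ≤ 1) (hq : ‖q‖ < 1) :
    HasSum (fun m : ℕ+ ↦ ∑' k : ℕ+, χ k * (q ^ (m : ℕ)) ^ (k : ℕ))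
      (∑' n : ℕ+, (∑ d ∈ (n : ℕ).divisors, χ d) * q ^ (n : ℕ)) := by
  refine (hasSum_lambert hχ hq).prod_fiberwise fun m ↦ ?_
  have := ((hasSum_lambert hχ hq).summable.prod_factor m).hasSum
  simpa only [pow_mul] using this

theorem hasSum_lambert_col (hχ : ∀ n, ‖χ n‖ ≤ 1) (hq : ‖q‖ < 1) :
    HasSum (fun d : ℕ+ ↦ χ d * ∑' k : ℕ+, (q ^ (d : ℕ)) ^ (k : ℕ))
      (∑' n : ℕ+, (∑ d ∈ (n : ℕ).divisors, χ d) * q ^ (n : ℕ)) := by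
  have h := (Equiv.prodComm ℕ+ ℕ+).hasSum_iff.mpr (hasSum_lambert hχ hq)
  refine h.prod_fiberwise fun d ↦ ?_
  have := (summable_pnat_pow (norm_pow_lt_one hq d.ne_zero)).hasSum.mul_left (χ d)
  simpa only [← pow_mul, Function.comp_apply, Equiv.prodComm_apply, Prod.swap, mul_comm] using this

end Lambert

/-! ### The weight one Eisenstein series of level three -/

section LevelThree

open Complex (cot integerComplement)

theorem norm_exp_lt_one_of_im_pos {a : ℂ} (ha : 0 < a.im) :
    ‖Complex.exp (2 * π * Complex.I * a)‖ < 1 :=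
  norm_exp_two_pi_I_lt_one ⟨a, ha⟩

theorem pi_mul_cot_eq_tsum_pnat {a : ℂ} (ha : 0 < a.im) :
    π * cot (π * a) = -π * Complex.I -
      2 * π * Complex.I * ∑' k : ℕ+, Complex.exp (2 * π * Complex.I * a) ^ (k : ℕ) := by
  have h : π * cot (π * a) = π * Complex.I -
      2 * π * Complex.I * ∑' k : ℕ, Complex.exp (2 * π * Complex.I * a) ^ k :=
    pi_mul_cot_pi_q_exp ⟨a, ha⟩
  have hr := norm_exp_lt_one_of_im_pos ha
  rw [h, ← tsum_zero_pnat_eq_tsum_nat (f := fun k ↦ Complex.exp (2 * π * Complex.I * a) ^ k)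
    (summable_geometric_of_norm_lt_one hr), pow_zero]
  ring

theorem pi_mul_cot_add_cot {z w : ℂ} (h1 : 0 < (w + z).im) (h2 : 0 < (w - z).im) :
    π * cot (π * (z + w)) + π * cot (π * (z - w)) = -2 * π * Complex.I *
      (∑' k : ℕ+, Complex.exp (2 * π * Complex.I * (w + z)) ^ (k : ℕ) -
        ∑' k : ℕ+, Complex.exp (2 * π * Complex.I * (w - z)) ^ (k : ℕ)) := by
  have h3 : cot (π * (z - w)) = -cot (π * (w - z)) := by
    rw [← neg_sub w z, mul_neg, Complex.cot, Complex.cot, Complex.cos_neg, Complex.sin_neg, div_neg]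
  rw [h3, mul_neg, add_comm z w, pi_mul_cot_eq_tsum_pnat h1, pi_mul_cot_eq_tsum_pnat h2]
  ring

theorem chiThree_apply (x : ZMod 3) :
    chiThree x = if x = 0 then 0 else if x = 1 then 1 else -1 := by
  have : ∀ x : ZMod 3, quadraticChar (ZMod 3) x = if x = 0 then 0 else if x = 1 then 1 else -1 := by
    decide
  rw [chiThree, MulChar.ringHomComp_apply, this]
  split_ifs <;> simp

theorem chiThree_natCast (n : ℕ) :
    chiThree ((3 * n : ℕ) : ZMod 3) = 0 ∧ chiThree ((3 * n + 1 : ℕ) : ZMod 3) = 1 ∧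
      chiThree ((3 * n + 2 : ℕ) : ZMod 3) = -1 := by
  have h3 : (3 : ZMod 3) = 0 := rfl
  have h2 : (2 : ZMod 3) ≠ 0 := by decide
  have h1 : (2 : ZMod 3) ≠ 1 := by decide
  push_cast
  simp [chiThree_apply, h3, h2, h1]

theorem norm_chiThree_le (n : ℕ) : ‖chiThree (n : ZMod 3)‖ ≤ 1 := by
  rw [chiThree_apply]
  split_ifs <;> simp

/-- The coefficients of the weight one Eisenstein series. -/
noncomputable def divisorChi (n : ℕ) : ℂ := ∑ d ∈ n.divisors, chiThree (d : ZMod 3)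

theorem norm_divisorChi_le (n : ℕ) : ‖divisorChi n‖ ≤ n ^ 1 := by
  refine (norm_sum_le_of_le _ fun d _ ↦ norm_chiThree_le d).trans ?_
  rw [Finset.sum_const, nsmul_eq_mul, mul_one, pow_one]
  exact_mod_cast Nat.card_divisors_le_self n

theorem eisensteinWeightOne_chiThree (τ : ℍ) :
    eisensteinWeightOne chiThree τ = 1 + 6 * qSeries divisorChi τ := by
  have hB : bernoulliOne chiThree = -1 / 3 := by
    have h2 : (2 : ZMod 3) ≠ 0 := by decide
    have h1 : (2 : ZMod 3) ≠ 1 := by decide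
    have h3 : (3 : ZMod 3) = 0 := rfl
    rw [bernoulliOne, Finset.sum_Icc_succ_top (by norm_num), Finset.sum_Icc_succ_top (by norm_num),
      Finset.Icc_self, Finset.sum_singleton]
    simp [chiThree_apply, h1, h2, h3]
    norm_num
  rw [eisensteinWeightOne, hB]
  change 1 - _ * qSeries divisorChi τ = _
  ring

/-- A primitive cube root of unity. -/
local notation "ω₃" => Complex.exp (2 * π * Complex.I / 3)

theorem cube_root_relations : ω₃ ^ 3 = 1 ∧ ω₃ ^ 2 + ω₃ + 1 = 0 := by
  have h : IsPrimitiveRoot ω₃ 3 := by exact_mod_cast Complex.isPrimitiveRoot_exp 3 (by norm_num)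
  refine ⟨h.pow_eq_one, ?_⟩
  have h1 : ω₃ - 1 ≠ 0 := sub_ne_zero.mpr (h.ne_one (by norm_num))
  refine (mul_eq_zero.mp ?_).resolve_left h1
  linear_combination h.pow_eq_one

/-- The Gauss sum of χ₃: it turns values at ±1/3 into character values. -/
theorem cube_root_pow_sub (k : ℕ) :
    ω₃ ^ k - (ω₃ ^ 2) ^ k = (ω₃ - ω₃ ^ 2) * chiThree (k : ZMod 3) := by
  obtain ⟨h3, -⟩ := cube_root_relations
  generalize ω₃ = w at *
  obtain ⟨c0, c1, c2⟩ := chiThree_natCast (k / 3)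
  have hk := Nat.div_add_mod k 3
  have hlt := Nat.mod_lt k (by norm_num : 3 > 0)
  generalize k / 3 = n at *
  have hn : w ^ (3 * n) = 1 := by rw [pow_mul, h3, one_pow]
  have hn' : (w ^ 2) ^ (3 * n) = 1 := by rw [← pow_mul, mul_comm, pow_mul, hn, one_pow]
  interval_cases k % 3 <;> subst hk
  · rw [add_zero, c0, hn, hn']; ring
  · rw [c1, pow_add, pow_add, hn, hn']; ring
  · rw [c2, pow_add, pow_add, hn, hn']; linear_combination -w * h3

theorem third_add_mem_integerComplement (τ : ℍ) (m : ℤ) :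
    (1 / 3 : ℂ) + m * τ ∈ integerComplement := by
  rintro ⟨n, hn⟩
  have h1 := congrArg Complex.im hn
  have h2 : (m : ℝ) = 0 := by
    simpa [τ.im_pos.ne'] using h1
  have h3 : (m : ℂ) = 0 := by exact_mod_cast h2
  rw [h3, zero_mul, add_zero] at hn
  have h4 : (n : ℂ) * 3 = 1 := by rw [hn]; norm_num
  have h5 : n * 3 = 1 := by exact_mod_cast h4
  omega

theorem div_three_add_mem_integerComplement (τ : ℍ) (m : ℤ) :
    (τ : ℂ) / 3 + m * τ ∈ integerComplement := by
  rintro ⟨n, hn⟩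
  have h1 := congrArg Complex.im hn
  have h2 : ((1 : ℝ) / 3 + m) * τ.im = 0 := by
    simp at h1
    linarith
  have h3 : (1 : ℝ) / 3 + m = 0 := (mul_eq_zero.mp h2).resolve_right τ.im_pos.ne'
  have h4 : (1 : ℝ) + 3 * m = 0 := by linarith
  have h5 : 1 + 3 * m = 0 := by exact_mod_cast h4
  omega

theorem pi_mul_cot_third_add (τ : ℍ) (m : ℕ) :
    π * cot (π * (1 / 3 + (m + 1 : ℕ) * τ)) + π * cot (π * (1 / 3 - (m + 1 : ℕ) * τ)) =
      -2 * π * Complex.I * (ω₃ - ω₃ ^ 2) * ∑' k : ℕ+, chiThree ((k : ℕ) : ZMod 3) *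
        (Complex.exp (2 * π * Complex.I * τ) ^ (m + 1)) ^ (k : ℕ) := by
  have him : 0 < ((m + 1 : ℕ) * (τ : ℂ)).im := im_natCast_mul_pos _ τ.im_pos
  have e1 : Complex.exp (2 * π * Complex.I * ((m + 1 : ℕ) * τ + 1 / 3)) =
      Complex.exp (2 * π * Complex.I * τ) ^ (m + 1) * ω₃ := by
    rw [← Complex.exp_nat_mul, ← Complex.exp_add]
    congr 1
    ring
  have e2 : Complex.exp (2 * π * Complex.I * ((m + 1 : ℕ) * τ - 1 / 3)) =
      Complex.exp (2 * π * Complex.I * τ) ^ (m + 1) * ω₃ ^ 2 := by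
    have : ω₃ ^ 2 = (ω₃)⁻¹ :=
      eq_inv_of_mul_eq_one_left (by rw [← pow_succ]; exact cube_root_relations.1)
    rw [this, ← Complex.exp_nat_mul, ← Complex.exp_neg, ← Complex.exp_add]
    congr 1
    ring
  have i1 : 0 < ((m + 1 : ℕ) * (τ : ℂ) + 1 / 3).im := by
    simpa using him
  have i2 : 0 < ((m + 1 : ℕ) * (τ : ℂ) - 1 / 3).im := by
    simpa using him
  have s1 := summable_pnat_pow (norm_exp_lt_one_of_im_pos i1)
  have s2 := summable_pnat_pow (norm_exp_lt_one_of_im_pos i2)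
  rw [pi_mul_cot_add_cot i1 i2, ← s1.tsum_sub s2, mul_assoc _ (ω₃ - ω₃ ^ 2)]
  refine congrArg (-2 * π * Complex.I * ·) ?_
  rw [← tsum_mul_left]
  refine tsum_congr fun k ↦ ?_
  rw [e1, e2, mul_pow, mul_pow, ← mul_sub, cube_root_pow_sub]
  ring

theorem cot_pi_div_three : cot (π * (1 / 3)) * (ω₃ - ω₃ ^ 2) = Complex.I := by
  obtain ⟨h3, h21⟩ := cube_root_relations
  rw [Complex.cot_pi_eq_exp_ratio, mul_one_div]
  generalize ω₃ = w at *
  have hw : 1 - w ≠ 0 := by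
    intro h
    have : w = 1 := by linear_combination -h
    rw [this] at h21
    norm_num at h21
  rw [div_mul_eq_mul_div, div_eq_iff (mul_ne_zero Complex.I_ne_zero hw)]
  linear_combination -h3 - (1 - w) * Complex.I_sq

/-- At z = 1/3 the m-th pair of cotangents is the m-th row of the Lambert series of χ₃, and cot(π/3)
supplies the constant term. -/
theorem latticeZeta_third (τ : ℍ) :
    (ω₃ - ω₃ ^ 2) * (latticeZeta (1 / 3) τ - 1 / 3 * EisensteinSeries.G2 τ) =
      π * Complex.I * eisensteinWeightOne chiThree τ := by
  obtain ⟨h3, h21⟩ := cube_root_relations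
  have lim := tendsto_cot_latticeZeta (third_add_mem_integerComplement τ)
  have lim2 := ((tendsto_sum_range_of_hasSum_pnat
    (f := fun m ↦ ∑' k : ℕ+, chiThree ((k : ℕ) : ZMod 3) *
      (Complex.exp (2 * π * Complex.I * τ) ^ m) ^ (k : ℕ))
    (hasSum_lambert_row (χ := fun n ↦ chiThree (n : ZMod 3)) norm_chiThree_le
      (norm_exp_two_pi_I_lt_one τ))).const_mul
    (-2 * π * Complex.I * (ω₃ - ω₃ ^ 2))).const_add (π * cot (π * (1 / 3)))
  simp only [pi_mul_cot_third_add, ← Finset.mul_sum] at lim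
  rw [tendsto_nhds_unique lim lim2, eisensteinWeightOne_chiThree]
  have hcot := cot_pi_div_three
  change (ω₃ - ω₃ ^ 2) * (π * cot (π * (1 / 3)) + -2 * π * Complex.I * (ω₃ - ω₃ ^ 2) *
    qSeries divisorChi τ) = _
  generalize qSeries divisorChi τ = A
  linear_combination π * hcot - 2 * π * Complex.I * A * ((ω₃ - 2) * h3 + h21)

/-- At z = τ/3 the pair for m involves the exponents 3m + 1 and 3m - 1 of e^(2πiτ/3) with opposite
signs. These are the values of χ₃, so partial sums run over columns d ≤ 3N + 1. -/
theorem pi_mul_cot_div_three_add (τ : ℍ) (N : ℕ) :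
    π * cot (π * (τ / 3)) + ∑ m ∈ Finset.range N,
      (π * cot (π * (τ / 3 + (m + 1 : ℕ) * τ)) + π * cot (π * (τ / 3 - (m + 1 : ℕ) * τ))) =
      -π * Complex.I - 2 * π * Complex.I * ∑ d ∈ Finset.range (3 * N + 1),
        chiThree ((d + 1 : ℕ) : ZMod 3) *
          ∑' k : ℕ+, (Complex.exp (2 * π * Complex.I * (τ / 3)) ^ (d + 1)) ^ (k : ℕ) := by
  have i0 : 0 < ((τ : ℂ) / 3).im := by simpa using τ.im_pos
  induction N with
  | zero =>
    have c1 := (chiThree_natCast 0).2.1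
    rw [Finset.sum_range_zero, add_zero, pi_mul_cot_eq_tsum_pnat i0, mul_zero, zero_add,
      Finset.sum_range_one, zero_add, pow_one]
    rw [mul_zero, zero_add] at c1
    rw [c1, one_mul]
  | succ N ih =>
    have i1 : 0 < ((N + 1 : ℕ) * (τ : ℂ) + τ / 3).im := by
      rw [Complex.add_im]
      exact add_pos (im_natCast_mul_pos _ τ.im_pos) i0
    have h2 : ((N + 1 : ℕ) * (τ : ℂ) - τ / 3) = (3 * N + 2 : ℕ) * (τ / 3) := by
      push_cast
      ring
    have h1 : ((N + 1 : ℕ) * (τ : ℂ) + τ / 3) = (3 * N + 4 : ℕ) * (τ / 3) := by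
      push_cast
      ring
    have i2 : 0 < ((N + 1 : ℕ) * (τ : ℂ) - τ / 3).im := by
      rw [h2]
      exact im_natCast_mul_pos _ i0
    have e (n : ℕ) : Complex.exp (2 * π * Complex.I * (n * (τ / 3))) =
        Complex.exp (2 * π * Complex.I * (τ / 3)) ^ n := by
      rw [← Complex.exp_nat_mul]
      congr 1
      ring
    have c2 : chiThree ((3 * N + 1 + 1 : ℕ) : ZMod 3) = -1 := (chiThree_natCast N).2.2
    have c3 : chiThree ((3 * N + 1 + 1 + 1 : ℕ) : ZMod 3) = 0 := (chiThree_natCast (N + 1)).1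
    have c4 : chiThree ((3 * N + 1 + 1 + 1 + 1 : ℕ) : ZMod 3) = 1 := (chiThree_natCast (N + 1)).2.1
    rw [Finset.sum_range_succ, ← add_assoc, ih, pi_mul_cot_add_cot i1 i2, h1, h2, e, e,
      show 3 * (N + 1) + 1 = 3 * N + 1 + 1 + 1 + 1 by ring,
      Finset.sum_range_succ _ (3 * N + 1 + 1 + 1), Finset.sum_range_succ _ (3 * N + 1 + 1),
      Finset.sum_range_succ _ (3 * N + 1), c2, c3, c4]
    ring

theorem latticeZeta_div_three (τ : ℍ) :
    latticeZeta (τ / 3) τ - τ / 3 * EisensteinSeries.G2 τ + 2 * π * Complex.I / 3 =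
      -(π * Complex.I / 3) *
        rescale (1 / 3) (one_div_pos.mpr three_pos) (eisensteinWeightOne chiThree) τ := by
  have lim := tendsto_cot_latticeZeta (div_three_add_mem_integerComplement τ)
  have i0 : 0 < ((τ : ℂ) / 3).im := by simpa using τ.im_pos
  have hN : Tendsto (fun N : ℕ ↦ 3 * N + 1) atTop atTop :=
    tendsto_atTop_mono (fun N ↦ (by omega : N ≤ 3 * N + 1)) tendsto_id
  have lim2 := (((tendsto_sum_range_of_hasSum_pnat
    (f := fun m ↦ chiThree (m : ZMod 3) * ∑' k : ℕ+,
      (Complex.exp (2 * π * Complex.I * (τ / 3)) ^ m) ^ (k : ℕ))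
    (hasSum_lambert_col (χ := fun n ↦ chiThree (n : ZMod 3)) norm_chiThree_le
      (norm_exp_lt_one_of_im_pos i0))).comp hN).const_mul
    (2 * π * Complex.I)).const_sub (-π * Complex.I)
  have h := tendsto_nhds_unique (lim.congr (pi_mul_cot_div_three_add τ)) lim2
  have h1 : (((⟨1 / 3, one_div_pos.mpr three_pos⟩ : {x : ℝ // 0 < x}) • τ : ℍ) : ℂ) = τ / 3 := by
    rw [coe_pos_smul]
    push_cast
    ring
  have h2 : qSeries divisorChi ((⟨1 / 3, one_div_pos.mpr three_pos⟩ : {x : ℝ // 0 < x}) • τ) =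
      ∑' n : ℕ+, (∑ d ∈ (n : ℕ).divisors, chiThree (d : ZMod 3)) *
        Complex.exp (2 * π * Complex.I * (τ / 3)) ^ (n : ℕ) := by
    rw [qSeries, h1]
    rfl
  rw [h, rescale, eisensteinWeightOne_chiThree, h2]
  ring

theorem exists_eisensteinWeightOne : ∃ a b : modularForms Γ(3) 1,
    (a : ℍ → ℂ) = rescale (1 / 3) (one_div_pos.mpr three_pos) (eisensteinWeightOne chiThree) ∧
      (b : ℍ → ℂ) = eisensteinWeightOne chiThree ∧
      Tendsto (a : ℍ → ℂ) atImInfty (𝓝 1) ∧ Tendsto (b : ℍ → ℂ) atImInfty (𝓝 1) ∧ a ≠ b := by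
  obtain ⟨h3, h21⟩ := cube_root_relations
  have hE : eisensteinWeightOne chiThree = fun τ ↦ 1 + 6 * qSeries divisorChi τ :=
    funext eisensteinWeightOne_chiThree
  have hb0 : divisorChi 0 = 0 := by simp [divisorChi]
  have hsq : (ω₃ - ω₃ ^ 2) * (ω₃ - ω₃ ^ 2) = -3 := by
    linear_combination (ω₃ - 2) * h3 + h21
  have hs0 : ω₃ - ω₃ ^ 2 ≠ 0 := by
    intro h
    rw [h] at hsq
    norm_num at hsq
  refine exists_forms_of_fricke (κ := -(ω₃ - ω₃ ^ 2) / 3) (by norm_num) (by norm_num) one_pos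
    (by decide) (fun h ↦ absurd h (by decide)) ?_ ?_ ?_
    (div_ne_zero (neg_ne_zero.mpr hs0) three_ne_zero) ?_
  · rw [hE]
    exact mdifferentiable_const.add (mdifferentiable_const.mul
      (mdifferentiable_qSeries norm_divisorChi_le hb0))
  · rw [hE]
    simpa using ((tendsto_qSeries norm_divisorChi_le hb0).const_mul 6).const_add 1
  · rw [slash_T_eq_iff, hE]
    intro τ
    simp only [qSeries_vadd]
  · ext τ
    have hτ := τ.ne_zero
    have h1 := latticeZeta_third (S • τ)
    have h2 := latticeZeta_div_three τ
    have h4 := latticeZeta_S_smul (τ / 3) τ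
    have hG := EisensteinSeries.G2_S_transform τ
    rw [show (τ : ℂ) / 3 / τ = 1 / 3 by field_simp] at h4
    rw [h4] at h1
    -- The anomaly -2πiτ of G₂, weighted by 1/3, yields exactly the summand 2πi/3 in
    -- `latticeZeta_div_three`; hence κ = -(ω₃ - ω₃²)/3.
    have hG' : EisensteinSeries.G2 (S • τ) =
        τ ^ 2 * EisensteinSeries.G2 τ - 2 * π * Complex.I * τ := by
      rw [hG]
      field_simp
      ring
    rw [hG'] at h1
    rw [slash_S_apply, Nat.cast_one, zpow_neg, zpow_one, mul_inv_eq_iff_eq_mul₀ hτ, Pi.smul_apply,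
      smul_eq_mul]
    refine mul_left_cancel₀ (mul_ne_zero (Complex.ofReal_ne_zero.mpr Real.pi_ne_zero)
      Complex.I_ne_zero) ?_
    rw [← h1]
    linear_combination (ω₃ - ω₃ ^ 2) * τ * h2

end LevelThree

end

theorem mainTheorem1 :
    (∃ e₁ e₂ f₁ f₂ : modularForms Γ(2) 2,
      (e₁ : ℍ → ℂ) = rescale (1 / 2) one_half_pos eisensteinTwoTwo ∧
      (e₂ : ℍ → ℂ) = eisensteinTwoTwo ∧
      (f₁ : ℍ → ℂ) = etaLower 2 ^ 4 ∧
      (f₂ : ℍ → ℂ) = etaUpper 2 ^ 4 ∧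
      IsPolynomialRingIn (ModularFormRing.ofForm e₁) (ModularFormRing.ofForm e₂) ∧
      IsPolynomialRingIn (ModularFormRing.ofForm f₁) (ModularFormRing.ofForm f₂)) ∧
    (∃ e₁ e₂ f₁ f₂ : modularForms Γ(3) 1,
      (e₁ : ℍ → ℂ) = rescale (1 / 3) (one_div_pos.mpr three_pos) (eisensteinWeightOne chiThree) ∧
      (e₂ : ℍ → ℂ) = eisensteinWeightOne chiThree ∧
      (f₁ : ℍ → ℂ) = etaLower 3 ∧
      (f₂ : ℍ → ℂ) = etaUpper 3 ∧
      IsPolynomialRingIn (ModularFormRing.ofForm e₁) (ModularFormRing.ofForm e₂) ∧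
      IsPolynomialRingIn (ModularFormRing.ofForm f₁) (ModularFormRing.ofForm f₂)) := by
  obtain ⟨x₂, y₂, hx₂, hy₂, h₂⟩ := exists_hasDivision_etaTwo
  obtain ⟨x₃, y₃, hx₃, hy₃, h₃⟩ := exists_hasDivision_etaThree
  obtain ⟨a₂, b₂, ha₂, hb₂, ta₂, tb₂, hab₂⟩ := exists_eisensteinTwoTwo
  obtain ⟨a₃, b₃, ha₃, hb₃, ta₃, tb₃, hab₃⟩ := exists_eisensteinWeightOne
  exact ⟨⟨a₂, b₂, x₂, y₂, ha₂, hb₂, hx₂, hy₂, h₂.isPolynomialRingIn_of_ne ta₂ tb₂ hab₂,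
    h₂.isPolynomialRingIn⟩, ⟨a₃, b₃, x₃, y₃, ha₃, hb₃, hx₃, hy₃,
    h₃.isPolynomialRingIn_of_ne ta₃ tb₃ hab₃, h₃.isPolynomialRingIn⟩⟩
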